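/- Let $\mathbb{K}$ be a field of characteristic zero. For $n\ge 1$ let $NAP(n)$ be the set of rooted trees with vertices labeled by $\{1,\dots,n\}$, and let $\mathbf{T}=\bigsqcup_n NAP(n)/S_n$ be the set of (unlabeled, non-planar) rooted trees, with $\bullet$ the one-vertex tree. For a tree $\alpha$ labeled by $\{1,\dots,n\}$ and trees $s_1,\dots,s_n$, let $\alpha(s_1,\dots,s_n)$ be the tree obtained from the disjoint union of the $s_i$ by adding, for each edge $\{i,j\}$ of $\alpha$, an edge between the roots of $s_i$ and $s_j$, the root being that of $s_k$ with $k$ the root of $\alpha$. Let $\mathcal{G}_{NAP}$ be the group of formal series $x=\sum_{T\in\mathbf{T}}x_T\,T$ over $\mathbb{K}$ with $x_\bullet=1$, where $x\cdot y$ is the series obtained by substituting $x$ into $y$: $$x\cdot y=\sum_{\alpha\in\mathbf T}\ \sum_{s_1,\dots,s_n\in\mathbf T} y_\alpha\,x_{s_1}\cdots x_{s_n}\,\alpha(s_1,\dots,s_n),$$ each $\alpha$ being given a fixed labeling of its $n$ vertices. Let $\mathbb{K}[\mathcal{G}_{NAP}]$ be its Hopf algebra of coordinate functions: the free commutative algebra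 on $g_T$, $T\neq\bullet$ (with $g_\bullet=1$), with the counit $\varepsilon(g_T)=0$ for $T\ne\bullet$ and the coproduct dual to the product of $\mathcal{G}_{NAP}$, i.e. $\Delta(g_T)=\sum_{\alpha(s_1,\dots,s_n)=T} g_{s_1}\cdots g_{s_n}\otimes g_\alpha$. Let $H_{CK}$ be the Connes–Kreimer Hopf algebra: the free commutative algebra on $\mathbf{T}$ with $\Delta(T)=T\otimes 1+1\otimes T+\sum_c P_c(T)\otimes R_c(T)$, the sum being over the non-trivial admissible cuts $c$ of $T$ (non-empty sets of edges meeting every path from the root in at most one edge; removing $c$ from $T$ leaves the tree $R_c(T)$ containing the root and the forest $P_c(T)$, a monomial in the other components), and $\varepsilon(T)=0$; let $G_{CK}(\mathbb{K})$ be the group of its characters (algebra morphisms $H_{CK}\to\mathbb{K}$) under convolution. There is a morphism of Hopf algebras $\varphi:\mathbb{K}[\mathcal{G}_{NAP}]\to H_{CK}$ such that: (i) $\varphi$ is surjective; (ii) consequently $G_{CK}(\mathbb{K})$ is a subgroup of $\mathcal{G}_{NAP}$: the map $\chi\mapsto\sum_{T}\chi(\varphi(g_T))\,T$ is an injective group homomorphism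 $G_{CK}(\mathbb{K})\to\mathcal{G}_{NAP}$. -/

import Mathlib

/- Main definitions: `NAP`, `NAP.comp`, `RTree` (rooted trees and the operad `NAP`);
`RTree.seriesComp`, `GNAP`, `CoordNAP` (the operadic group and its Hopf algebra of coordinates);
`NAP.piece`, `NAP.IsAdmissibleCut`, `HCK` (the Connes–Kreimer Hopf algebra). The theorems are only
used to build the group and Hopf algebra structures. -/

open scoped TensorProduct

/-- A rooted tree with vertex set `I`. The tree is encoded by its root and by the map sending every
vertex to its parent (the root being sent to itself); each vertex is connected to the root. For
finite `I` this is an element of `NAP(I)`: a rooted tree with vertices labeled by `I`. -/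
@[ext]
structure NAP (I : Type) where
  root : I
  parent : I → I
  parent_root : parent root = root
  reach : ∀ v, ∃ n : ℕ, parent^[n] v = root

namespace NAP

variable {I J : Type}

/-- Transport of a labeled rooted tree along a bijection of the label sets. -/
def relabel (e : I ≃ J) (t : NAP I) : NAP J where
  root := e t.root
  parent := fun v => e (t.parent (e.symm v))
  parent_root := by simp [t.parent_root]
  reach := fun v => by
    obtain ⟨n, hn⟩ := t.reach (e.symm v)
    refine ⟨n, ?_⟩
    have h : Function.Semiconj e t.parent (fun v => e (t.parent (e.symm v))) := fun w => by simp
    have := (h.iterate_right n) (e.symm v)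
    simp only [Equiv.apply_symm_apply] at this
    rw [← this, hn]

/-- The rooted tree with a single vertex. -/
def single : NAP Unit where
  root := ()
  parent := id
  parent_root := rfl
  reach := fun _ => ⟨0, rfl⟩

open Classical in
/-- The composition `t ((s i)_{i ∈ I})` of the operad `NAP`: take the disjoint union of the trees
`s i` and, for each edge of `t` between `i` and `j`, add an edge between the roots of `s i` and of
`s j`; the root is the root of `s k`, where `k` is the root of `t`. -/
noncomputable def comp (t : NAP I) {J : I → Type} (s : ∀ i, NAP (J i)) : NAP (Σ i, J i) where
  root := ⟨t.root, (s t.root).root⟩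
  parent := fun v =>
    if v.2 = (s v.1).root then ⟨t.parent v.1, (s (t.parent v.1)).root⟩
    else ⟨v.1, (s v.1).parent v.2⟩
  parent_root := by rw [if_pos rfl, t.parent_root]
  reach := by
    set p : (Σ i, J i) → (Σ i, J i) := fun v =>
      if v.2 = (s v.1).root then ⟨t.parent v.1, (s (t.parent v.1)).root⟩
      else ⟨v.1, (s v.1).parent v.2⟩ with hp
    have h1 : ∀ n i, p^[n] ⟨i, (s i).root⟩ = ⟨t.parent^[n] i, (s (t.parent^[n] i)).root⟩ := by
      intro n
      induction n with
      | zero => intro i; rfl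
      | succ n ih =>
        intro i
        rw [Function.iterate_succ_apply, Function.iterate_succ_apply, ← ih]
        simp [hp]
    have h2 : ∀ n i (v : J i), (s i).parent^[n] v = (s i).root →
        ∃ m, p^[m] ⟨i, v⟩ = ⟨i, (s i).root⟩ := by
      intro n
      induction n with
      | zero => intro i v hv; exact ⟨0, by simpa using hv⟩
      | succ n ih =>
        intro i v hv
        by_cases hr : v = (s i).root
        · exact ⟨0, by simp [hr]⟩
        · obtain ⟨m, hm⟩ := ih i ((s i).parent v) hv
          refine ⟨m + 1, ?_⟩
          rw [Function.iterate_succ_apply, ← hm]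
          simp [hp, hr]
    rintro ⟨i, v⟩
    obtain ⟨n, hn⟩ := (s i).reach v
    obtain ⟨m, hm⟩ := h2 n i v hn
    obtain ⟨k, hk⟩ := t.reach i
    refine ⟨k + m, ?_⟩
    rw [Function.iterate_add_apply, hm, h1, hk]

/-- The vertices of the connected component at `r` that remain below `r` after removing from `t` the
edges joining a vertex of `c` to its parent. -/
def pieceSet (t : NAP I) (c : Set I) (r : I) : Set I :=
  {w | ∃ n : ℕ, t.parent^[n] w = r ∧ ∀ k < n, t.parent^[k] w ∉ c}

theorem self_mem_pieceSet (t : NAP I) (c : Set I) (r : I) : r ∈ t.pieceSet c r :=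
  ⟨0, rfl, fun _ h => absurd h (Nat.not_lt_zero _)⟩

theorem parent_mem_pieceSet (t : NAP I) (c : Set I) (r : I) {w : I} (hw : w ∈ t.pieceSet c r)
    (hr : w ≠ r) : t.parent w ∈ t.pieceSet c r := by
  obtain ⟨n, hn, h⟩ := hw
  cases n with
  | zero => exact absurd hn hr
  | succ n => exact ⟨n, hn, fun k hk => h (k + 1) (by omega)⟩

open Classical in
/-- The connected component `pieceSet t c r`, as a rooted tree with root `r`. -/
noncomputable def piece (t : NAP I) (c : Set I) (r : I) : NAP (t.pieceSet c r) where
  root := ⟨r, t.self_mem_pieceSet c r⟩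
  parent := fun w => if h : w.1 = r then w else ⟨t.parent w.1, t.parent_mem_pieceSet c r w.2 h⟩
  parent_root := by simp
  reach := by
    set p : t.pieceSet c r → t.pieceSet c r := fun w =>
      if h : w.1 = r then w else ⟨t.parent w.1, t.parent_mem_pieceSet c r w.2 h⟩ with hp
    have h : ∀ n (w : t.pieceSet c r), t.parent^[n] w.1 = r →
        ∃ m, p^[m] w = ⟨r, t.self_mem_pieceSet c r⟩ := by
      intro n
      induction n with
      | zero => intro w hw; exact ⟨0, Subtype.ext hw⟩
      | succ n ih =>
        intro w hw
        by_cases hr : w.1 = r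
        · exact ⟨0, Subtype.ext hr⟩
        · obtain ⟨m, hm⟩ := ih ⟨t.parent w.1, t.parent_mem_pieceSet c r w.2 hr⟩ hw
          refine ⟨m + 1, ?_⟩
          rw [Function.iterate_succ_apply, ← hm]
          simp [hp, hr]
    intro w
    obtain ⟨n, hn, -⟩ := w.2
    exact h n w hn

/-- An admissible cut of `t`: a set of edges (the edge from a vertex `v ≠ root` to its parent being
represented by `v`) such that any path from the root meets at most one of them. -/
def IsAdmissibleCut (t : NAP I) (c : Finset I) : Prop :=
  t.root ∉ c ∧ ∀ v ∈ c, ∀ n : ℕ, t.parent^[n + 1] v ∉ c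

end NAP

/-- Two rooted trees on `{1, …, m}` and `{1, …, n}` are equivalent if they differ by a bijection of
the vertex sets; thus `m = n` and they are in the same orbit of the symmetric group. -/
instance NAP.setoid : Setoid (Σ n : ℕ, NAP (Fin n)) where
  r s t := ∃ e : Fin s.1 ≃ Fin t.1, s.2.relabel e = t.2
  iseqv :=
    { refl := fun _ => ⟨Equiv.refl _, rfl⟩
      symm := by
        rintro ⟨m, s⟩ ⟨n, t⟩ ⟨e, he⟩
        refine ⟨e.symm, ?_⟩
        change s.relabel e = t at he
        change t.relabel e.symm = s
        rw [← he]
        ext <;> simp [NAP.relabel]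
      trans := by
        rintro ⟨m, s⟩ ⟨n, t⟩ ⟨l, u⟩ ⟨e, he⟩ ⟨f, hf⟩
        refine ⟨e.trans f, ?_⟩
        change s.relabel e = t at he
        change t.relabel f = u at hf
        change s.relabel (e.trans f) = u
        rw [← hf, ← he]
        ext <;> simp [NAP.relabel] }

/-- The set of (unlabeled, non-planar) rooted trees: the disjoint union over `n` of the sets of
orbits `NAP(n) / S_n`. It is the canonical basis of `⨁ n, 𝕂 (NAP_n)_{S_n}`. -/
def RTree : Type := Quotient NAP.setoid

namespace RTree

/-- The number of vertices. -/
noncomputable def size (T : RTree) : ℕ := (Quotient.out T).1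

/-- A labeled representative of an unlabeled rooted tree. -/
noncomputable def rep (T : RTree) : NAP (Fin T.size) := (Quotient.out T).2

end RTree

/-- The unlabeled rooted tree underlying a rooted tree with a finite set of vertices. -/
noncomputable def NAP.cls {I : Type} [Finite I] (t : NAP I) : RTree :=
  Quotient.mk _ ⟨Nat.card I, t.relabel (Finite.equivFin I)⟩

/-- The unlabeled rooted tree with a single vertex. -/
noncomputable def RTree.dot : RTree := NAP.single.cls

namespace NAP

variable {I J : Type}

theorem relabel_symm (e : I ≃ J) (t : NAP I) : (t.relabel e).relabel e.symm = t := by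
  ext <;> simp [relabel]

theorem cls_eq_iff [Finite I] [Finite J] (s : NAP I) (t : NAP J) :
    s.cls = t.cls ↔ ∃ e : I ≃ J, s.relabel e = t := by
  refine Iff.trans (Quotient.eq (r := NAP.setoid)) ?_
  constructor
  · rintro ⟨e, he⟩
    refine ⟨((Finite.equivFin I).trans e).trans (Finite.equivFin J).symm, ?_⟩
    dsimp only at he
    have := congrArg (relabel (Finite.equivFin J).symm) he
    have h2 : relabel (Finite.equivFin J).symm (relabel (Finite.equivFin J) t) = t := by
      ext <;> simp [relabel]
    rw [h2] at this
    rw [← this]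
    ext <;> simp [relabel]
  · rintro ⟨e, rfl⟩
    refine ⟨((Finite.equivFin I).symm.trans e).trans (Finite.equivFin J), ?_⟩
    ext <;> simp [relabel]

theorem cls_eq_of_equiv [Finite I] [Finite J] {s : NAP I} {t : NAP J} (e : I ≃ J)
    (h : ∀ v, e (s.parent v) = t.parent (e v)) : s.cls = t.cls := by
  rw [cls_eq_iff]
  refine ⟨e, ?_⟩
  have hp : ∀ n v, e (s.parent^[n] v) = t.parent^[n] (e v) := fun n =>
    (Function.Semiconj.iterate_right (f := e) h n)
  have hfix : ∀ v, t.parent v = v → v = t.root := by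
    intro v hv
    obtain ⟨n, hn⟩ := t.reach v
    rwa [Function.iterate_fixed hv] at hn
  have hroot : e s.root = t.root := hfix _ (by rw [← h, s.parent_root])
  ext v
  · exact hroot
  · simp [relabel, h]

theorem exists_equiv_of_cls_eq [Finite I] [Finite J] {s : NAP I} {t : NAP J}
    (h : s.cls = t.cls) : ∃ e : I ≃ J, e s.root = t.root ∧ ∀ v, e (s.parent v) = t.parent (e v) := by
  obtain ⟨e, rfl⟩ := (cls_eq_iff s t).1 h
  exact ⟨e, rfl, fun v => by simp [relabel]⟩

end NAP

namespace RTree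

theorem cls_rep (T : RTree) : T.rep.cls = T := by
  refine Eq.trans ?_ (Quotient.out_eq T)
  refine (Quotient.eq (r := NAP.setoid)).2 ?_
  exact ⟨(Finite.equivFin _).symm, NAP.relabel_symm _ T.rep⟩

theorem exists_equiv_rep {I : Type} [Finite I] (t : NAP I) :
    ∃ e : I ≃ Fin t.cls.size, e t.root = t.cls.rep.root ∧
      ∀ v, e (t.parent v) = t.cls.rep.parent (e v) :=
  NAP.exists_equiv_of_cls_eq (cls_rep t.cls).symm

theorem size_cls {I : Type} [Finite I] (t : NAP I) : t.cls.size = Nat.card I := by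
  obtain ⟨e, -⟩ := exists_equiv_rep t
  rw [Nat.card_congr e, Nat.card_fin]

theorem size_pos (T : RTree) : 0 < T.size :=
  (Nat.zero_le _).trans_lt T.rep.root.2

theorem size_dot : dot.size = 1 := by
  simp [dot, size_cls]

theorem eq_dot_of_size {T : RTree} (h : T.size = 1) : T = dot := by
  rw [← cls_rep T]
  have : Subsingleton (Fin T.size) := by rw [h]; infer_instance
  let e : Fin T.size ≃ Unit :=
    ⟨fun _ => (), fun _ => T.rep.root, fun _ => Subsingleton.elim _ _, fun _ => rfl⟩
  exact NAP.cls_eq_of_equiv e (fun v => rfl)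

instance (n : ℕ) : Finite (NAP (Fin n)) :=
  Finite.of_injective (fun t : NAP (Fin n) => (t.root, t.parent)) fun s t h => by
    simp only [Prod.mk.injEq] at h
    exact NAP.ext h.1 h.2

theorem finite_size_le (n : ℕ) : {T : RTree | T.size ≤ n}.Finite := by
  have : Finite (Σ m : Fin (n + 1), NAP (Fin m)) := inferInstance
  refine (Set.finite_range (fun p : (Σ m : Fin (n + 1), NAP (Fin m)) => p.2.cls)).subset ?_
  intro T hT
  exact ⟨⟨⟨T.size, Nat.lt_succ_of_le hT⟩, T.rep⟩, cls_rep T⟩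

/-- The class of the composition `α (s 1, …, s n)` of unlabeled trees, for `α` with `n` vertices. -/
noncomputable def subst (α : RTree) (s : Fin α.size → RTree) : RTree :=
  (α.rep.comp fun i => (s i).rep).cls

theorem size_subst (α : RTree) (s : Fin α.size → RTree) :
    (α.subst s).size = ∑ i, (s i).size := by
  simp [subst, size_cls]

theorem size_le_subst (α : RTree) (s : Fin α.size → RTree) : α.size ≤ (α.subst s).size := by
  rw [size_subst]
  calc α.size = ∑ _i : Fin α.size, 1 := by simp
    _ ≤ _ := Finset.sum_le_sum fun i _ => size_pos _

theorem size_apply_le_subst (α : RTree) (s : Fin α.size → RTree) (i : Fin α.size) :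
    (s i).size ≤ (α.subst s).size := by
  rw [size_subst]
  exact Finset.single_le_sum (f := fun i => (s i).size) (fun _ _ => Nat.zero_le _)
    (Finset.mem_univ i)

theorem finite_decomp (T : RTree) :
    {p : Σ α : RTree, (Fin α.size → RTree) | p.1.subst p.2 = T}.Finite := by
  have hfin : Finite {S : RTree // S.size ≤ T.size} := finite_size_le T.size
  refine (Set.finite_range (fun p : (Σ α : {S : RTree // S.size ≤ T.size},
    (Fin α.1.size → {S : RTree // S.size ≤ T.size})) =>
      (⟨p.1.1, fun i => (p.2 i).1⟩ : Σ α : RTree, (Fin α.size → RTree)))).subset ?_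
  rintro ⟨α, s⟩ h
  have h' : α.subst s = T := h
  exact ⟨⟨⟨α, h' ▸ size_le_subst α s⟩, fun i => ⟨s i, h' ▸ size_apply_le_subst α s i⟩⟩, rfl⟩

/-- The finite set of all pairs `(α, s)` of a tree `α` and a family `s` of trees indexed by the
vertices of (a labeled representative of) `α` such that `α (s 1, …, s n) = T`. -/
noncomputable def decomp (T : RTree) : Finset (Σ α : RTree, (Fin α.size → RTree)) :=
  T.finite_decomp.toFinset

theorem mem_decomp {T : RTree} {p : Σ α : RTree, (Fin α.size → RTree)} :
    p ∈ T.decomp ↔ p.1.subst p.2 = T := by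
  simp [decomp]

end RTree

namespace NAP

variable {I : Type}

/-- A morphism-of-parents bijection identifies roots. -/
theorem root_of_equiv {J : Type} {s : NAP I} {t : NAP J} (e : I ≃ J)
    (h : ∀ v, e (s.parent v) = t.parent (e v)) : e s.root = t.root := by
  have hfix : ∀ v, t.parent v = v → v = t.root := by
    intro v hv
    obtain ⟨n, hn⟩ := t.reach v
    rwa [Function.iterate_fixed hv] at hn
  exact hfix _ (by rw [← h, s.parent_root])

theorem comp_parent_root (t : NAP I) {J : I → Type} (s : ∀ i, NAP (J i)) (i : I) :
    (t.comp s).parent ⟨i, (s i).root⟩ = ⟨t.parent i, (s (t.parent i)).root⟩ := by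
  simp only [comp, if_true]

theorem comp_parent_of_ne (t : NAP I) {J : I → Type} (s : ∀ i, NAP (J i)) (i : I) (v : J i)
    (h : v ≠ (s i).root) : (t.comp s).parent ⟨i, v⟩ = ⟨i, (s i).parent v⟩ := by
  simp only [comp, h, if_false]

theorem cls_comp_congr {I' : Type} [Finite I] [Finite I'] {J : I → Type} {J' : I' → Type}
    [∀ i, Finite (J i)] [∀ i, Finite (J' i)]
    (t : NAP I) (t' : NAP I') (s : ∀ i, NAP (J i)) (s' : ∀ i, NAP (J' i)) (e : I ≃ I')
    (he : ∀ v, e (t.parent v) = t'.parent (e v)) (h : ∀ i, (s i).cls = (s' (e i)).cls) :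
    (t.comp s).cls = (t'.comp s').cls := by
  choose f hf hf' using fun i => exists_equiv_of_cls_eq (h i)
  refine cls_eq_of_equiv (Equiv.sigmaCongr e f) ?_
  rintro ⟨i, v⟩
  change Equiv.sigmaCongr e f _ = (t'.comp s').parent ⟨e i, f i v⟩
  by_cases hv : v = (s i).root
  · subst hv
    rw [comp_parent_root, hf, comp_parent_root, ← he, ← hf]
    rfl
  · have hr : f i v ≠ (s' (e i)).root := by
      rwa [← hf i, Ne, (f i).apply_eq_iff_eq]
    rw [comp_parent_of_ne _ _ _ _ hv, comp_parent_of_ne _ _ _ _ hr, ← hf']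
    rfl

theorem cls_comp_comp [Finite I] {J : I → Type} [∀ i, Finite (J i)] {L : (Σ i, J i) → Type}
    [∀ p, Finite (L p)] (t : NAP I) (s : ∀ i, NAP (J i)) (u : ∀ p, NAP (L p)) :
    ((t.comp s).comp u).cls = (t.comp fun i => (s i).comp fun j => u ⟨i, j⟩).cls := by
  refine cls_eq_of_equiv (Equiv.sigmaAssoc fun i j => L ⟨i, j⟩) ?_
  rintro ⟨⟨i, j⟩, v⟩
  change _ = (t.comp fun i => (s i).comp fun j => u ⟨i, j⟩).parent ⟨i, ⟨j, v⟩⟩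
  by_cases hv : v = (u ⟨i, j⟩).root
  · subst hv
    rw [comp_parent_root]
    by_cases hj : j = (s i).root
    · subst hj
      rw [comp_parent_root]
      exact (comp_parent_root t (fun i => (s i).comp fun j => u ⟨i, j⟩) i).symm
    · rw [comp_parent_of_ne t s _ _ hj, comp_parent_of_ne t (fun i => (s i).comp fun j => u ⟨i, j⟩)]
      · exact congrArg (Sigma.mk i) (comp_parent_root (s i) (fun j => u ⟨i, j⟩) j).symm
      · exact fun h => hj (congrArg Sigma.fst h)
  · rw [comp_parent_of_ne _ u _ _ hv, comp_parent_of_ne t (fun i => (s i).comp fun j => u ⟨i, j⟩)]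
    · exact congrArg (Sigma.mk i) (comp_parent_of_ne (s i) (fun j => u ⟨i, j⟩) j v hv).symm
    · rintro h
      change (⟨j, v⟩ : Σ j, L ⟨i, j⟩) = ⟨(s i).root, (u ⟨i, (s i).root⟩).root⟩ at h
      obtain ⟨rfl, h⟩ := Sigma.mk.inj_iff.1 h
      exact hv (eq_of_heq h)

end NAP

namespace RTree

variable {R : Type*} [CommRing R]

/-- Composition of formal power series indexed by rooted trees induced by the operad `NAP`:
`(∑ f_α α) (∑ g_β β) = ∑_α ∑_{s 1, …, s n} f_α g_{s 1} ⋯ g_{s n} α (s 1, …, s n)`. -/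
noncomputable def seriesComp (f g : RTree → R) : RTree → R :=
  fun T => ∑ p ∈ T.decomp, f p.1 * ∏ i, g (p.2 i)

/-- The series `•`. -/
noncomputable def seriesOne : RTree → R := fun T => by
  classical exact if T = dot then 1 else 0

theorem subst_cls {I : Type} [Fintype I] (t : NAP I) (e : I ≃ Fin t.cls.size)
    (he : ∀ v, e (t.parent v) = t.cls.rep.parent (e v)) (s : Fin t.cls.size → RTree) :
    t.cls.subst s = (t.comp fun i => (s (e i)).rep).cls :=
  (NAP.cls_comp_congr _ _ _ _ e he fun _ => rfl).symm

theorem seriesComp_assoc (f g h : RTree → R) :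
    seriesComp (seriesComp f g) h = seriesComp f (seriesComp g h) := by
  classical
  funext T
  have key : ∀ (α : RTree) (r : Fin α.size → RTree),
    ∃ e : (Σ i, Fin (r i).size) ≃ Fin (α.subst r).size,
      ∀ s : Fin (α.subst r).size → RTree,
        (α.subst r).subst s = α.subst fun i => (r i).subst fun j => s (e ⟨i, j⟩) := by
    intro α r
    obtain ⟨e, -, he⟩ := exists_equiv_rep (α.rep.comp fun i => (r i).rep)
    refine ⟨e, fun s => ?_⟩
    refine (subst_cls _ e he s).trans ?_
    refine (NAP.cls_comp_comp _ _ _).trans ?_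
    exact NAP.cls_comp_congr _ _ _ _ (Equiv.refl _) (fun _ => rfl) fun i => (cls_rep _).symm
  choose e he using key
  have hL : seriesComp (seriesComp f g) h T = ∑ x ∈ T.decomp.sigma fun p => p.1.decomp,
      f x.2.1 * (∏ i, g (x.2.2 i)) * ∏ j, h (x.1.2 j) := by
    rw [Finset.sum_sigma]
    simp only [seriesComp, Finset.sum_mul]
  have hR : seriesComp f (seriesComp g h) T =
      ∑ x ∈ T.decomp.sigma fun p => Fintype.piFinset fun i => (p.2 i).decomp,
      f x.1.1 * ∏ i, (g (x.2 i).1 * ∏ j, h ((x.2 i).2 j)) := by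
    rw [Finset.sum_sigma]
    simp only [seriesComp, Finset.prod_univ_sum, Finset.mul_sum]
  rw [hL, hR]
  have hS : ∀ (α : RTree) (q : Fin α.size → Σ α : RTree, (Fin α.size → RTree)),
      ∃ s : Fin (α.subst fun i => (q i).1).size → RTree,
        ∀ i j, s (e α (fun i => (q i).1) ⟨i, j⟩) = (q i).2 j := fun α q =>
    ⟨fun k => (q ((e α fun i => (q i).1).symm k).1).2 ((e α fun i => (q i).1).symm k).2,
      fun i j => congrArg (fun p : (Σ i, Fin (q i).1.size) => (q p.1).2 p.2)
        (Equiv.symm_apply_apply _ _)⟩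
  choose S hS using hS
  have hS' : ∀ (α : RTree) (r : Fin α.size → RTree) (s : Fin (α.subst r).size → RTree),
      S α (fun i => ⟨r i, fun j => s (e α r ⟨i, j⟩)⟩) = s := by
    intro α r s
    funext k
    obtain ⟨⟨i, j⟩, rfl⟩ := (e α r).surjective k
    exact hS α (fun i => ⟨r i, fun j => s (e α r ⟨i, j⟩)⟩) i j
  have hl : ∀ x : (Σ p : (Σ α : RTree, (Fin α.size → RTree)), Σ α : RTree, (Fin α.size → RTree)),
      ∃ l : ∀ i : Fin x.2.1.size, Fin (x.2.2 i).size → RTree,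
        ∀ h : x.2.1.subst x.2.2 = x.1.1, ∀ i j, l i j = x.1.2 (h ▸ e x.2.1 x.2.2 ⟨i, j⟩) := by
    intro x
    by_cases h : x.2.1.subst x.2.2 = x.1.1
    · exact ⟨fun i j => x.1.2 (h ▸ e x.2.1 x.2.2 ⟨i, j⟩), fun _ _ _ => rfl⟩
    · exact ⟨fun _ _ => dot, fun h' => absurd h' h⟩
  choose l hl using hl
  have hl' : ∀ (α : RTree) (r : Fin α.size → RTree) (s : Fin (α.subst r).size → RTree),
      l ⟨⟨α.subst r, s⟩, ⟨α, r⟩⟩ = fun i j => s (e α r ⟨i, j⟩) := fun α r s =>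
    funext fun i => funext fun j => hl _ rfl i j
  refine Finset.sum_bij'
    (fun x _ => ⟨⟨x.2.1, fun i => (x.2.2 i).subst (l x i)⟩, fun i => ⟨x.2.2 i, l x i⟩⟩)
    (fun y _ => ⟨⟨y.1.1.subst fun i => (y.2 i).1, S y.1.1 y.2⟩, ⟨y.1.1, fun i => (y.2 i).1⟩⟩)
    ?_ ?_ ?_ ?_ ?_
  · rintro ⟨⟨β, s⟩, ⟨α, r⟩⟩ hx
    simp only [Finset.mem_sigma, mem_decomp] at hx
    obtain ⟨h1, rfl⟩ := hx
    simp only [Finset.mem_sigma, mem_decomp, Fintype.mem_piFinset, implies_true, and_true, hl']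
    rw [← h1, he]
  · rintro ⟨⟨α, u⟩, q⟩ hy
    simp only [Finset.mem_sigma, mem_decomp, Fintype.mem_piFinset] at hy
    obtain ⟨h1, h2⟩ := hy
    change Fin α.size → Σ α : RTree, (Fin α.size → RTree) at q
    obtain rfl : u = fun i => (q i).1.subst (q i).2 := funext fun i => (h2 i).symm
    simp only [Finset.mem_sigma, mem_decomp, and_true]
    rw [← h1, he]
    simp only [hS]
  · rintro ⟨⟨β, s⟩, ⟨α, r⟩⟩ hx
    simp only [Finset.mem_sigma, mem_decomp] at hx
    obtain ⟨h1, rfl⟩ := hx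
    have h4 := hl' α r s
    dsimp only
    revert h4
    generalize l ⟨⟨α.subst r, s⟩, ⟨α, r⟩⟩ = l'
    rintro rfl
    exact congrArg (fun z => (⟨⟨α.subst r, z⟩, ⟨α, r⟩⟩ :
      Σ _ : (Σ α : RTree, (Fin α.size → RTree)), Σ α : RTree, (Fin α.size → RTree))) (hS' α r s)
  · rintro ⟨⟨α, u⟩, q⟩ hy
    simp only [Finset.mem_sigma, mem_decomp, Fintype.mem_piFinset] at hy
    obtain ⟨h1, h2⟩ := hy
    change Fin α.size → Σ α : RTree, (Fin α.size → RTree) at q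
    obtain rfl : u = fun i => (q i).1.subst (q i).2 := funext fun i => (h2 i).symm
    have h4 := (hl' α (fun i => (q i).1) (S α q)).trans
      (funext fun i => funext fun j => hS α q i j)
    dsimp only
    revert h4
    generalize l ⟨⟨α.subst fun i => (q i).1, S α q⟩, ⟨α, fun i => (q i).1⟩⟩ = l'
    rintro rfl
    rfl
  · rintro ⟨⟨β, s⟩, ⟨α, r⟩⟩ hx
    simp only [Finset.mem_sigma, mem_decomp] at hx
    obtain ⟨h1, rfl⟩ := hx
    simp only [hl']
    rw [Finset.prod_mul_distrib, mul_assoc, ← Fintype.prod_sigma', ← (e α r).prod_comp]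

theorem dot_subst (s : Fin dot.size → RTree) (i : Fin dot.size) : dot.subst s = s i := by
  have hs : Subsingleton (Fin dot.size) := by rw [size_dot]; infer_instance
  refine Eq.trans ?_ (cls_rep (s i))
  let e : (Σ i, Fin (s i).size) ≃ Fin (s i).size :=
    { toFun := fun p => Subsingleton.elim p.1 i ▸ p.2
      invFun := fun j => ⟨i, j⟩
      left_inv := by
        rintro ⟨k, v⟩
        obtain rfl := Subsingleton.elim k i
        rfl
      right_inv := fun j => rfl }
  refine NAP.cls_eq_of_equiv e ?_
  rintro ⟨k, v⟩
  obtain rfl := Subsingleton.elim k i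
  by_cases hv : v = (s k).rep.root
  · have h2 : dot.rep.parent k = k := Subsingleton.elim _ _
    have : (dot.rep.comp fun i => (s i).rep).parent ⟨k, v⟩ = ⟨k, v⟩ := by
      simp only [NAP.comp, hv, if_true]
      rw [h2]
    rw [this, hv]
    exact (NAP.parent_root _).symm
  · simp [NAP.comp, hv, e]

theorem subst_dot (α : RTree) : (α.subst fun _ => dot) = α := by
  refine Eq.trans ?_ (cls_rep α)
  have hs : Subsingleton (Fin dot.size) := by rw [size_dot]; infer_instance
  let e : (Σ _ : Fin α.size, Fin dot.size) ≃ Fin α.size :=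
    { toFun := fun p => p.1
      invFun := fun j => ⟨j, dot.rep.root⟩
      left_inv := by
        rintro ⟨k, v⟩
        obtain rfl := Subsingleton.elim v dot.rep.root
        rfl
      right_inv := fun j => rfl }
  refine NAP.cls_eq_of_equiv e ?_
  rintro ⟨k, v⟩
  obtain rfl := Subsingleton.elim v dot.rep.root
  simp [NAP.comp, e]

theorem seriesOne_comp (g : RTree → R) : seriesComp seriesOne g = g := by
  classical
  funext T
  have hs : Subsingleton (Fin dot.size) := by rw [size_dot]; infer_instance
  have hp : ∀ s : Fin dot.size → RTree, ∏ i, g (s i) = g (dot.subst s) := by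
    intro s
    rw [dot_subst s dot.rep.root]
    exact Fintype.prod_subsingleton _ _
  unfold seriesComp
  rw [Finset.sum_eq_single (⟨dot, fun _ => T⟩ : Σ α : RTree, (Fin α.size → RTree))]
  · dsimp only
    rw [hp, dot_subst _ dot.rep.root]
    simp [seriesOne]
  · rintro ⟨α, s⟩ hα hne
    rw [mem_decomp] at hα
    dsimp only at hα ⊢
    have : α ≠ dot := by
      rintro rfl
      apply hne
      obtain rfl : s = fun _ => T := funext fun i => by rw [← hα, dot_subst s i]
      rfl
    simp [seriesOne, this]
  · intro h
    exact absurd (mem_decomp.2 (dot_subst _ dot.rep.root)) h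

theorem seriesComp_one (f : RTree → R) : seriesComp f seriesOne = f := by
  classical
  funext T
  unfold seriesComp
  rw [Finset.sum_eq_single (⟨T, fun _ => dot⟩ : Σ α : RTree, (Fin α.size → RTree))]
  · simp [seriesOne]
  · rintro ⟨α, s⟩ hα hne
    rw [mem_decomp] at hα
    dsimp only at hα ⊢
    have : ∃ i, s i ≠ dot := by
      by_contra! hcon
      apply hne
      obtain rfl : s = fun _ => dot := funext hcon
      rw [subst_dot] at hα
      rw [hα]
    obtain ⟨i, hi⟩ := this
    rw [Finset.prod_eq_zero (Finset.mem_univ i), mul_zero]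
    simp [seriesOne, hi]
  · intro h
    exact absurd (mem_decomp.2 (subst_dot T)) h

theorem eq_dot_of_size_le {α : RTree} {s : Fin α.size → RTree}
    (h : (α.subst s).size ≤ α.size) : s = fun _ => dot := by
  rw [size_subst] at h
  have h1 : ∑ i : Fin α.size, 1 = ∑ i, (s i).size :=
    le_antisymm (Finset.sum_le_sum fun i _ => size_pos _) (by simpa using h)
  have h2 := (Finset.sum_eq_sum_iff_of_le fun i _ => size_pos (s i)).1 h1
  exact funext fun i => eq_dot_of_size (h2 i (Finset.mem_univ i)).symm

/-- The left inverse for composition of a series with constant term `1`, defined recursively. -/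
noncomputable def seriesInv (g : RTree → R) (T : RTree) : R :=
  seriesOne T - ∑ p ∈ T.decomp.attach,
    if _h : p.1.1.size < T.size then seriesInv g p.1.1 * ∏ i, g (p.1.2 i) else 0
termination_by T.size

theorem seriesInv_comp (g : RTree → R) (hg : g dot = 1) :
    seriesComp (seriesInv g) g = seriesOne := by
  classical
  funext T
  have h1 : seriesInv g T = seriesOne T - ∑ p ∈ T.decomp,
      if p.1.size < T.size then seriesInv g p.1 * ∏ i, g (p.2 i) else 0 := by
    rw [seriesInv]
    congr 1
    rw [← Finset.sum_attach T.decomp]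
    refine Finset.sum_congr rfl fun p _ => ?_
    split_ifs <;> rfl
  have h2 : seriesComp (seriesInv g) g T =
      (∑ p ∈ T.decomp, if p.1.size < T.size then seriesInv g p.1 * ∏ i, g (p.2 i) else 0) +
      ∑ p ∈ T.decomp, if p.1.size < T.size then 0 else seriesInv g p.1 * ∏ i, g (p.2 i) := by
    rw [← Finset.sum_add_distrib]
    refine Finset.sum_congr rfl fun p _ => ?_
    split_ifs <;> simp
  have h3 : (∑ p ∈ T.decomp, if p.1.size < T.size then 0
      else seriesInv g p.1 * ∏ i, g (p.2 i)) = seriesInv g T := by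
    rw [Finset.sum_eq_single (⟨T, fun _ => dot⟩ : Σ α : RTree, (Fin α.size → RTree))]
    · simp [hg]
    · rintro ⟨α, s⟩ hα hne
      rw [mem_decomp] at hα
      dsimp only at hα ⊢
      rw [if_pos]
      by_contra hcon
      apply hne
      obtain rfl := eq_dot_of_size_le (α := α) (s := s) (by rw [hα]; omega)
      rw [subst_dot] at hα
      rw [hα]
    · intro h
      exact absurd (mem_decomp.2 (subst_dot T)) h
  rw [h2, h3, h1]
  ring

theorem seriesComp_dot (f g : RTree → R) : seriesComp f g dot = f dot * g dot := by
  classical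
  unfold seriesComp
  have hs : Subsingleton (Fin dot.size) := by rw [size_dot]; infer_instance
  rw [Finset.sum_eq_single (⟨dot, fun _ => dot⟩ : Σ α : RTree, (Fin α.size → RTree))]
  · dsimp only
    rw [Fintype.prod_subsingleton _ dot.rep.root]
  · rintro ⟨α, s⟩ hα hne
    rw [mem_decomp] at hα
    dsimp only at hα
    have h1 : α = dot := by
      apply eq_dot_of_size
      have := size_le_subst α s
      rw [hα, size_dot] at this
      have := size_pos α
      omega
    subst h1
    obtain rfl := eq_dot_of_size_le (α := dot) (s := s) (by rw [hα])
    exact absurd rfl hne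
  · intro h
    exact absurd (mem_decomp.2 (subst_dot dot)) h

theorem seriesInv_dot (g : RTree → R) (hg : g dot = 1) : seriesInv g dot = 1 := by
  have := congrFun (seriesInv_comp g hg) dot
  rw [seriesComp_dot, hg, mul_one] at this
  rw [this]
  simp [seriesOne]

theorem seriesOne_dot : (seriesOne dot : R) = 1 := by simp [seriesOne]

end RTree

namespace RTree

variable {R : Type*} [CommRing R]

open Classical in
/-- The convolution product of (the multiplicative extensions to forests of) two functions on rooted
trees: `(x * y)(T) = x(T) + ∑_c x(P_c(T)) y(R_c(T))`, where `c` runs over the admissible cuts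
(including the empty one) of a labeled representative. -/
noncomputable def ckConv (x y : RTree → R) (T : RTree) : R :=
  x T + ∑ c : Finset (Fin T.size) with T.rep.IsAdmissibleCut c,
    (∏ v ∈ c, x (T.rep.piece c v).cls) * y (T.rep.piece c T.rep.root).cls

end RTree

namespace NAP

variable {I J : Type}

theorem iterate_parent_root (t : NAP I) (n : ℕ) : t.parent^[n] t.root = t.root :=
  Function.iterate_fixed t.parent_root n

theorem eq_root_of_parent (t : NAP I) {v : I} (h : t.parent v = v) : v = t.root := by
  obtain ⟨n, hn⟩ := t.reach v
  rwa [Function.iterate_fixed h] at hn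

theorem mem_pieceSet_of_parent (t : NAP I) (c : Set I) {r w : I} (hc : w ∉ c)
    (h : t.parent w ∈ t.pieceSet c r) : w ∈ t.pieceSet c r := by
  obtain ⟨n, hn, hk⟩ := h
  refine ⟨n + 1, hn, fun k hk' => ?_⟩
  cases k with
  | zero => exact hc
  | succ k => exact hk k (by omega)

theorem pieceSet_induction (t : NAP I) (c : Set I) (r : I) {P : I → Prop} (h0 : P r)
    (h1 : ∀ w, w ∉ c → t.parent w ∈ t.pieceSet c r → P (t.parent w) → P w) :
    ∀ w ∈ t.pieceSet c r, P w := by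
  rintro w ⟨n, hn, hk⟩
  induction n generalizing w with
  | zero =>
    have hn' : w = r := hn
    rw [hn']
    exact h0
  | succ n ih =>
    exact h1 w (hk 0 (by omega)) ⟨n, hn, fun k hk' => hk (k + 1) (by omega)⟩
      (ih _ hn fun k hk' => hk (k + 1) (by omega))

theorem root_mem_pieceSet (t : NAP I) (c : Set I) (r : I) (h : t.root ∈ t.pieceSet c r) :
    r = t.root := by
  obtain ⟨n, hn, -⟩ := h
  rw [← hn, iterate_parent_root]

theorem coe_piece_parent_of_ne (t : NAP I) (c : Set I) (r : I) (w : t.pieceSet c r)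
    (h : w.1 ≠ r) : ((t.piece c r).parent w).1 = t.parent w.1 := by
  simp [piece, h]

theorem piece_parent_of_eq (t : NAP I) (c : Set I) (r : I) (w : t.pieceSet c r)
    (h : w.1 = r) : (t.piece c r).parent w = w := by
  simp [piece, h]

theorem cls_piece_congr [Finite I] (t : NAP I) {c d : Set I} {r : I}
    (h : t.pieceSet c r = t.pieceSet d r) : (t.piece c r).cls = (t.piece d r).cls := by
  refine cls_eq_of_equiv (Equiv.setCongr h) ?_
  intro w
  by_cases hw : w.1 = r
  · rw [piece_parent_of_eq _ _ _ _ hw, piece_parent_of_eq]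
    exact hw
  · apply Subtype.ext
    refine Eq.trans (coe_piece_parent_of_ne t c r w hw) ?_
    exact (coe_piece_parent_of_ne t d r ⟨w.1, h ▸ w.2⟩ hw).symm

theorem cls_piece_eq_self [Finite I] (t : NAP I) {c : Set I}
    (h : ∀ w, w ∈ t.pieceSet c t.root) : (t.piece c t.root).cls = t.cls := by
  refine cls_eq_of_equiv (Equiv.subtypeUnivEquiv h) ?_
  intro w
  by_cases hw : w.1 = t.root
  · rw [piece_parent_of_eq _ _ _ _ hw]
    change w.1 = t.parent w.1
    rw [hw, t.parent_root]
  · exact coe_piece_parent_of_ne _ _ _ _ hw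

/-- The edges that do not lie inside `A`. -/
def cutOf (t : NAP I) (A : Finset I) : Set I := {u | u ∉ A ∨ t.parent u ∉ A}

theorem pieceSet_cutOf_subset (t : NAP I) (A : Finset I) {v : I} (hv : v ∈ A) :
    ∀ w ∈ t.pieceSet (t.cutOf A) v, w ∈ A :=
  t.pieceSet_induction _ _ hv fun w hw _ _ => by
    by_contra h
    exact hw (Or.inl h)

section Forests

open Classical

variable {R : Type*} [CommRing R]

/-- The roots of the forest spanned by `A`. -/
noncomputable def tops (t : NAP I) (A : Finset I) : Finset I :=
  A.filter fun v => v = t.root ∨ t.parent v ∉ A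

/-- The value on the forest spanned by `A` of the multiplicative extension of `x`. -/
noncomputable def forestVal [Finite I] (x : RTree → R) (t : NAP I) (A : Finset I) : R :=
  ∏ v ∈ t.tops A, x (t.piece (t.cutOf A) v).cls

/-- `B` is closed under taking parents inside `A`. -/
def LowerIn (t : NAP I) (A B : Finset I) : Prop := ∀ v ∈ B, t.parent v ∈ A → t.parent v ∈ B

/-- The convolution evaluated on the forest spanned by `A`. -/
noncomputable def forestConv [Finite I] (x y : RTree → R) (t : NAP I) (A : Finset I) : R :=
  ∑ B ∈ A.powerset with t.LowerIn A B, forestVal x t (A \ B) * forestVal y t B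

/-- `f` embeds `t'` as a connected piece of `t`. -/
structure IsEmb (t' : NAP J) (t : NAP I) (f : J ↪ I) : Prop where
  par : ∀ u, u ≠ t'.root → f (t'.parent u) = t.parent (f u)
  rt : f t'.root = t.root ∨ t.parent (f t'.root) ∉ Set.range f

theorem IsEmb.mem_iff {t' : NAP J} {t : NAP I} {f : J ↪ I} (hf : IsEmb t' t f) (Q : Finset J)
    (v : J) (u : I) : u ∈ t.pieceSet (t.cutOf (Q.map f)) (f v) ↔
      ∃ w ∈ t'.pieceSet (t'.cutOf Q) v, f w = u := by
  constructor
  · revert u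
    refine pieceSet_induction _ _ _ ⟨v, self_mem_pieceSet _ _ _, rfl⟩ ?_
    rintro u hu - ⟨w', hw', hw⟩
    simp only [cutOf, Set.mem_ofPred_eq, not_or, not_not] at hu
    obtain ⟨w, hwQ, rfl⟩ := Finset.mem_map.1 hu.1
    refine ⟨w, ?_, rfl⟩
    by_cases hr : w = t'.root
    · subst hr
      rcases hf.rt with h | h
      · rw [h, t.parent_root, ← h] at hw
        rwa [f.injective hw] at hw'
      · exact absurd ⟨w', hw⟩ h
    · rw [← hf.par w hr] at hw
      have hw2 := f.injective hw
      subst hw2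
      refine mem_pieceSet_of_parent _ _ ?_ hw'
      have h2 := hu.2
      rw [← hf.par w hr, Finset.mem_map' f] at h2
      simp only [cutOf, Set.mem_ofPred_eq, not_or, not_not]
      exact ⟨hwQ, h2⟩
  · rintro ⟨w, hw, rfl⟩
    revert w
    refine pieceSet_induction _ _ _ (self_mem_pieceSet _ _ _) ?_
    intro w hw hw2 ih
    by_cases hr : w = t'.root
    · subst hr
      rwa [t'.parent_root] at ih
    · rw [hf.par w hr] at ih
      refine mem_pieceSet_of_parent _ _ ?_ ih
      simp only [cutOf, Set.mem_ofPred_eq, not_or, not_not] at hw ⊢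
      rw [← hf.par w hr, Finset.mem_map' f, Finset.mem_map' f]
      exact hw

theorem IsEmb.forestVal_map [Finite I] [Finite J] {t' : NAP J} {t : NAP I} {f : J ↪ I}
    (hf : IsEmb t' t f) (x : RTree → R) (Q : Finset J) :
    forestVal x t (Q.map f) = forestVal x t' Q := by
  have ht : t.tops (Q.map f) = (t'.tops Q).map f := by
    ext u
    simp only [tops, Finset.mem_filter, Finset.mem_map]
    constructor
    · rintro ⟨⟨w, hw, rfl⟩, h⟩
      refine ⟨w, ⟨hw, ?_⟩, rfl⟩
      by_cases hr : w = t'.root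
      · exact Or.inl hr
      · right
        intro hp
        rcases h with h | h
        · have h2 := hf.par w hr
          rw [h, t.parent_root, ← h] at h2
          exact hr (t'.eq_root_of_parent (f.injective h2))
        · exact h ⟨_, hp, hf.par w hr⟩
    · rintro ⟨w, ⟨hw, h⟩, rfl⟩
      refine ⟨⟨w, hw, rfl⟩, ?_⟩
      by_cases hr : w = t'.root
      · subst hr
        exact hf.rt.imp_right fun h2 ⟨a, _, ha⟩ => h2 ⟨a, ha⟩
      · right
        rintro ⟨a, ha, h2⟩
        rw [← hf.par w hr] at h2
        rw [f.injective h2] at ha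
        exact (h.resolve_left hr) ha
  unfold forestVal
  rw [ht, Finset.prod_map]
  refine Finset.prod_congr rfl fun v _ => ?_
  congr 1
  symm
  refine cls_eq_of_equiv (Equiv.ofBijective
    (fun w => (⟨f w.1, (hf.mem_iff Q v _).2 ⟨w.1, w.2, rfl⟩⟩ :
      t.pieceSet (t.cutOf (Q.map f)) (f v))) ⟨?_, ?_⟩) ?_
  · intro a b hab
    exact Subtype.ext (f.injective (congrArg Subtype.val hab))
  · rintro ⟨u, hu⟩
    obtain ⟨w, hw, rfl⟩ := (hf.mem_iff Q v _).1 hu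
    exact ⟨⟨w, hw⟩, rfl⟩
  · intro w
    by_cases hw : w.1 = v
    · rw [piece_parent_of_eq _ _ _ _ hw]
      symm
      apply piece_parent_of_eq
      exact congrArg f hw
    · apply Subtype.ext
      refine Eq.trans ?_ (coe_piece_parent_of_ne t _ _ _ ?_).symm
      · change f ((t'.piece _ v).parent w).1 = t.parent (f w.1)
        rw [coe_piece_parent_of_ne _ _ _ _ hw]
        refine hf.par _ fun hr => hw ?_
        have := w.2
        rw [hr] at this ⊢
        exact (root_mem_pieceSet _ _ _ this).symm
      · exact fun h => hw (f.injective h)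

theorem IsEmb.lowerIn_map {t' : NAP J} {t : NAP I} {f : J ↪ I} (hf : IsEmb t' t f)
    (Q B : Finset J) : t.LowerIn (Q.map f) (B.map f) ↔ t'.LowerIn Q B := by
  constructor
  · intro h v hv hp
    by_cases hr : v = t'.root
    · rw [hr, t'.parent_root, ← hr]
      exact hv
    · have := h (f v) (Finset.mem_map_of_mem f hv)
      rw [← hf.par v hr, Finset.mem_map' f, Finset.mem_map' f] at this
      exact this hp
  · intro h u hu hp
    obtain ⟨v, hv, rfl⟩ := Finset.mem_map.1 hu
    by_cases hr : v = t'.root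
    · subst hr
      rcases hf.rt with h2 | h2
      · rw [h2, t.parent_root, ← h2]
        exact hu
      · obtain ⟨a, _, ha⟩ := Finset.mem_map.1 hp
        exact absurd ⟨a, ha⟩ h2
    · rw [← hf.par v hr, Finset.mem_map' f] at hp ⊢
      exact h v hv hp

theorem IsEmb.forestConv_map [Finite I] [Finite J] {t' : NAP J} {t : NAP I} {f : J ↪ I}
    (hf : IsEmb t' t f) (x y : RTree → R) (Q : Finset J) :
    forestConv x y t (Q.map f) = forestConv x y t' Q := by
  unfold forestConv
  symm
  refine Finset.sum_bij (fun B _ => B.map f) ?_ ?_ ?_ ?_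
  · intro B hB
    rw [Finset.mem_filter, Finset.mem_powerset] at hB ⊢
    exact ⟨Finset.map_subset_map.2 hB.1, (hf.lowerIn_map Q B).2 hB.2⟩
  · intro B _ B' _ h
    exact Finset.map_injective f h
  · intro B hB
    rw [Finset.mem_filter, Finset.mem_powerset] at hB
    obtain ⟨B', hB', rfl⟩ := Finset.subset_map_iff.1 hB.1
    exact ⟨B', by
      rw [Finset.mem_filter, Finset.mem_powerset]
      exact ⟨hB', (hf.lowerIn_map Q B').1 hB.2⟩, rfl⟩
  · intro B hB
    rw [← Finset.map_sdiff, hf.forestVal_map, hf.forestVal_map]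

theorem forestVal_empty [Finite I] (x : RTree → R) (t : NAP I) : forestVal x t ∅ = 1 := by
  simp [forestVal, tops]

theorem forestVal_univ [Fintype I] (x : RTree → R) (t : NAP I) :
    forestVal x t Finset.univ = x t.cls := by
  have : t.tops Finset.univ = {t.root} := by
    ext v
    simp [tops]
  rw [forestVal, this, Finset.prod_singleton, cls_piece_eq_self]
  intro w
  obtain ⟨n, hn⟩ := t.reach w
  exact ⟨n, hn, fun k _ => by simp [cutOf]⟩

theorem cutSum_eq_forestConv [Fintype I] (x y : RTree → R) (t : NAP I) :
    x t.cls + ∑ c : Finset I with t.IsAdmissibleCut c,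
      (∏ v ∈ c, x (t.piece c v).cls) * y (t.piece c t.root).cls =
    forestConv x y t Finset.univ := by
  have hmem : ∅ ∈ (Finset.univ : Finset I).powerset.filter (t.LowerIn Finset.univ) := by
    simp [LowerIn]
  unfold forestConv
  rw [← Finset.add_sum_erase _ _ hmem, Finset.sdiff_empty, forestVal_univ, forestVal_empty, mul_one]
  congr 1
  have htr : ∀ c : Finset I, t.IsAdmissibleCut c → ∀ v : I,
      v ∉ t.pieceSet c t.root → v ∉ c → t.parent v ∉ t.pieceSet c t.root := by
    intro c hc v hv hvc hp
    exact hv (mem_pieceSet_of_parent _ _ (by simpa using hvc) hp)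
  have hc1 : ∀ c : Finset I, t.IsAdmissibleCut c → ∀ v ∈ c,
      v ∉ t.pieceSet c t.root := by
    rintro c hc v hv ⟨n, hn, hk⟩
    cases n with
    | zero => exact hc.1 (hn ▸ hv)
    | succ n => exact hk 0 (by omega) (by simpa using hv)
  have hc2 : ∀ c : Finset I, t.IsAdmissibleCut c → ∀ v ∈ c,
      t.parent v ∈ t.pieceSet c t.root := by
    rintro c hc v hv
    obtain ⟨n, hn⟩ := t.reach (t.parent v)
    exact ⟨n, hn, fun k _ => by simpa using hc.2 v hv k⟩
  have htops : ∀ c : Finset I, t.IsAdmissibleCut c →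
      t.tops (Finset.univ \ Finset.univ.filter (· ∈ t.pieceSet c t.root)) = c := by
    intro c hc
    ext v
    simp only [tops, Finset.mem_filter, Finset.mem_sdiff, Finset.mem_univ, true_and, not_not]
    constructor
    · rintro ⟨h1, h2⟩
      by_contra hv
      rcases h2 with h2 | h2
      · exact h1 (h2 ▸ self_mem_pieceSet _ _ _)
      · exact htr c hc v h1 hv h2
    · intro hv
      exact ⟨hc1 c hc v hv, Or.inr (hc2 c hc v hv)⟩
  refine Finset.sum_bij' (fun c _ => Finset.univ.filter (· ∈ t.pieceSet c t.root))
    (fun B _ => t.tops (Finset.univ \ B)) ?_ ?_ ?_ ?_ ?_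
  · intro c hc
    simp only [Finset.mem_filter, Finset.mem_univ, true_and] at hc
    rw [Finset.mem_erase, Finset.mem_filter]
    refine ⟨fun h => ?_, by simp, ?_⟩
    · have : t.root ∈ Finset.univ.filter (· ∈ t.pieceSet c t.root) := by
        simp [self_mem_pieceSet]
      rw [h] at this
      simp at this
    · intro v hv _
      simp only [Finset.mem_filter, Finset.mem_univ, true_and] at hv ⊢
      by_cases hr : v = t.root
      · rw [hr, t.parent_root]
        exact self_mem_pieceSet _ _ _
      · exact parent_mem_pieceSet _ _ _ hv hr
  · intro B hB
    rw [Finset.mem_erase, Finset.mem_filter] at hB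
    obtain ⟨hne, -, hlow⟩ := hB
    simp only [LowerIn, Finset.mem_univ, true_implies] at hlow
    have hit : ∀ n, ∀ v ∈ B, t.parent^[n] v ∈ B := by
      intro n
      induction n with
      | zero => exact fun v hv => hv
      | succ n ih => exact fun v hv => ih _ (hlow v hv)
    have hroot : t.root ∈ B := by
      obtain ⟨v, hv⟩ := Finset.nonempty_iff_ne_empty.2 hne
      obtain ⟨n, hn⟩ := t.reach v
      exact hn ▸ hit n v hv
    simp only [Finset.mem_filter, Finset.mem_univ, true_and]
    constructor
    · simp [tops, hroot]
    · intro v hv n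
      simp only [tops, Finset.mem_filter, Finset.mem_sdiff, Finset.mem_univ, true_and,
        not_not] at hv ⊢
      rcases hv.2 with h | h
      · exact absurd (h ▸ hroot) hv.1
      · exact fun h2 => h2.1 (hit n _ h)
  · intro c hc
    simp only [Finset.mem_filter, Finset.mem_univ, true_and] at hc
    exact htops c hc
  · intro B hB
    rw [Finset.mem_erase, Finset.mem_filter] at hB
    obtain ⟨hne, -, hlow⟩ := hB
    simp only [LowerIn, Finset.mem_univ, true_implies] at hlow
    have hit : ∀ n, ∀ v ∈ B, t.parent^[n] v ∈ B := by
      intro n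
      induction n with
      | zero => exact fun v hv => hv
      | succ n ih => exact fun v hv => ih _ (hlow v hv)
    have hroot : t.root ∈ B := by
      obtain ⟨v, hv⟩ := Finset.nonempty_iff_ne_empty.2 hne
      obtain ⟨n, hn⟩ := t.reach v
      exact hn ▸ hit n v hv
    ext w
    simp only [Finset.mem_filter, Finset.mem_univ, true_and]
    constructor
    · revert w
      refine pieceSet_induction _ _ _ hroot ?_
      intro w hw _ hp
      by_contra hwB
      apply hw
      simp only [tops, Finset.coe_filter, Finset.mem_sdiff, Finset.mem_univ, true_and,
        Set.mem_ofPred_eq, not_not]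
      exact ⟨hwB, Or.inr hp⟩
    · intro hw
      obtain ⟨n, hn⟩ := t.reach w
      refine ⟨n, hn, fun k _ h => ?_⟩
      simp only [tops, Finset.coe_filter, Finset.mem_sdiff, Finset.mem_univ, true_and,
        Set.mem_ofPred_eq] at h
      exact h.1 (hit k w hw)
  · intro c hc
    simp only [Finset.mem_filter, Finset.mem_univ, true_and] at hc
    congr 1
    · unfold forestVal
      rw [htops c hc]
      refine Finset.prod_congr rfl fun v hv => ?_
      congr 1
      apply cls_piece_congr
      ext w
      constructor
      · revert w
        refine pieceSet_induction _ _ _ (self_mem_pieceSet _ _ _) ?_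
        intro w hw hp ih
        refine mem_pieceSet_of_parent _ _ ?_ ih
        have hnot : ∀ u ∈ t.pieceSet c v, u ∉ t.pieceSet c t.root :=
          pieceSet_induction _ _ _ (hc1 c hc v hv) fun u hu hu' hpu h2 => by
            by_cases hr : u = t.root
            · exact hpu (by rw [hr, t.parent_root]; exact self_mem_pieceSet _ _ _)
            · exact hpu (parent_mem_pieceSet _ _ _ h2 hr)
        simp only [cutOf, Set.mem_ofPred_eq, not_or, not_not, Finset.mem_sdiff, Finset.mem_univ,
          Finset.mem_filter, true_and]
        exact ⟨hnot w (mem_pieceSet_of_parent _ _ hw hp), hnot _ hp⟩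
      · revert w
        refine pieceSet_induction _ _ _ (self_mem_pieceSet _ _ _) ?_
        intro w hw hp ih
        refine mem_pieceSet_of_parent _ _ ?_ ih
        simp only [cutOf, Set.mem_ofPred_eq, not_or, not_not, Finset.mem_sdiff, Finset.mem_univ,
          Finset.mem_filter, true_and] at hw
        exact fun h => hw.2 (hc2 c hc w (by simpa using h))
    · have ht1 : t.tops (Finset.univ.filter (· ∈ t.pieceSet c t.root)) = {t.root} := by
        ext v
        simp only [tops, Finset.mem_filter, Finset.mem_univ, true_and, Finset.mem_singleton]
        constructor
        · rintro ⟨h1, h2⟩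
          by_contra hr
          exact (h2.resolve_left hr) (parent_mem_pieceSet _ _ _ h1 hr)
        · rintro rfl
          exact ⟨self_mem_pieceSet _ _ _, Or.inl rfl⟩
      unfold forestVal
      rw [ht1, Finset.prod_singleton]
      congr 1
      apply cls_piece_congr
      ext w
      constructor
      · revert w
        refine pieceSet_induction _ _ _ (self_mem_pieceSet _ _ _) ?_
        intro w hw hp ih
        refine mem_pieceSet_of_parent _ _ ?_ ih
        simp only [cutOf, Set.mem_ofPred_eq, not_or, not_not, Finset.mem_univ,
          Finset.mem_filter, true_and]
        exact ⟨mem_pieceSet_of_parent _ _ hw hp, hp⟩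
      · intro hw
        have := pieceSet_cutOf_subset t (Finset.univ.filter (· ∈ t.pieceSet c t.root))
          (v := t.root) (by simp [self_mem_pieceSet]) w hw
        simpa using this

theorem ckConv_eq_forestConv_rep (x y : RTree → R) (T : RTree) :
    RTree.ckConv x y T = forestConv x y T.rep Finset.univ := by
  have h := cutSum_eq_forestConv x y T.rep
  rw [RTree.cls_rep] at h
  exact h

theorem ckConv_cls [Fintype I] (x y : RTree → R) (t : NAP I) :
    RTree.ckConv x y t.cls = forestConv x y t Finset.univ := by
  obtain ⟨e, he, hp⟩ := RTree.exists_equiv_rep t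
  have hf : IsEmb t t.cls.rep e.toEmbedding := ⟨fun u _ => hp u, Or.inl he⟩
  rw [ckConv_eq_forestConv_rep, ← hf.forestConv_map, Finset.map_univ_equiv]

/-- There is no edge between `A` and `B`. -/
def Separated (t : NAP I) (A B : Finset I) : Prop :=
  Disjoint A B ∧ (∀ v ∈ A, t.parent v ∉ B) ∧ ∀ v ∈ B, t.parent v ∉ A

theorem Separated.symm {t : NAP I} {A B : Finset I} (h : t.Separated A B) : t.Separated B A :=
  ⟨h.1.symm, h.2.2, h.2.1⟩

theorem Separated.mono {t : NAP I} {A B A' B' : Finset I} (h : t.Separated A B) (hA : A' ⊆ A)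
    (hB : B' ⊆ B) : t.Separated A' B' :=
  ⟨h.1.mono hA hB, fun v hv h' => h.2.1 v (hA hv) (hB h'), fun v hv h' => h.2.2 v (hB hv) (hA h')⟩

theorem Separated.pieceSet_eq {t : NAP I} {A B : Finset I} (h : t.Separated A B) {v : I}
    (hv : v ∈ A) : t.pieceSet (t.cutOf (A ∪ B)) v = t.pieceSet (t.cutOf A) v := by
  ext w
  constructor
  · revert w
    refine pieceSet_induction _ _ _ (self_mem_pieceSet _ _ _) ?_
    intro w hw _ ih
    refine mem_pieceSet_of_parent _ _ ?_ ih
    have hpA := pieceSet_cutOf_subset t A hv _ ih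
    simp only [cutOf, Set.mem_ofPred_eq, not_or, not_not, Finset.mem_union] at hw ⊢
    exact ⟨by
      by_contra hwA
      by_cases hwB : w ∈ B
      · exact h.2.2 w hwB hpA
      · exact hw.1 ⟨hwA, hwB⟩, hpA⟩
  · revert w
    refine pieceSet_induction _ _ _ (self_mem_pieceSet _ _ _) ?_
    intro w hw _ ih
    refine mem_pieceSet_of_parent _ _ ?_ ih
    simp only [cutOf, Set.mem_ofPred_eq, not_or, not_not, Finset.mem_union] at hw ⊢
    exact ⟨fun h' => h'.1 hw.1, fun h' => h'.1 hw.2⟩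

theorem Separated.forestVal_union [Finite I] {t : NAP I} {A B : Finset I} (h : t.Separated A B)
    (x : RTree → R) : forestVal x t (A ∪ B) = forestVal x t A * forestVal x t B := by
  have ht : t.tops (A ∪ B) = t.tops A ∪ t.tops B := by
    ext v
    simp only [tops, Finset.mem_filter, Finset.mem_union]
    have h1 := h.2.1 v
    have h2 := h.2.2 v
    tauto
  have hA : t.tops A ⊆ A := Finset.filter_subset _ _
  have hB : t.tops B ⊆ B := Finset.filter_subset _ _
  unfold forestVal
  rw [ht, Finset.prod_union (h.1.mono hA hB)]
  congr 1
  · refine Finset.prod_congr rfl fun v hv => ?_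
    rw [cls_piece_congr t (h.pieceSet_eq (hA hv))]
  · refine Finset.prod_congr rfl fun v hv => ?_
    rw [Finset.union_comm, cls_piece_congr t (h.symm.pieceSet_eq (hB hv))]

theorem Separated.forestConv_union [Finite I] {t : NAP I} {A B : Finset I} (h : t.Separated A B)
    (x y : RTree → R) : forestConv x y t (A ∪ B) = forestConv x y t A * forestConv x y t B := by
  unfold forestConv
  rw [Finset.sum_mul_sum, ← Finset.sum_product']
  have hd := Finset.disjoint_left.1 h.1
  have hS : ∀ {C : Finset I}, C ⊆ A ∪ B → C ∩ A ∪ C ∩ B = C := fun {C} hC => by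
    rw [← Finset.inter_union_distrib_left, Finset.inter_eq_left.2 hC]
  refine Finset.sum_bij' (fun C _ => (C ∩ A, C ∩ B)) (fun p _ => p.1 ∪ p.2) ?_ ?_ ?_ ?_ ?_
  · intro C hC
    simp only [Finset.mem_filter, Finset.mem_powerset, Finset.mem_product] at hC ⊢
    refine ⟨⟨Finset.inter_subset_right, fun v hv hp => ?_⟩,
      ⟨Finset.inter_subset_right, fun v hv hp => ?_⟩⟩
    · rw [Finset.mem_inter] at hv ⊢
      exact ⟨hC.2 v hv.1 (Finset.mem_union_left _ hp), hp⟩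
    · rw [Finset.mem_inter] at hv ⊢
      exact ⟨hC.2 v hv.1 (Finset.mem_union_right _ hp), hp⟩
  · rintro ⟨C, D⟩ hCD
    simp only [Finset.mem_filter, Finset.mem_powerset, Finset.mem_product] at hCD ⊢
    obtain ⟨⟨hC, hC'⟩, ⟨hD, hD'⟩⟩ := hCD
    refine ⟨Finset.union_subset_union hC hD, fun v hv hp => ?_⟩
    rw [Finset.mem_union] at hv hp ⊢
    rcases hv with hv | hv
    · exact Or.inl (hC' v hv (hp.resolve_right (h.2.1 v (hC hv))))
    · exact Or.inr (hD' v hv (hp.resolve_left (h.2.2 v (hD hv))))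
  · intro C hC
    simp only [Finset.mem_filter, Finset.mem_powerset] at hC
    exact hS hC.1
  · rintro ⟨C, D⟩ hCD
    simp only [Finset.mem_filter, Finset.mem_powerset, Finset.mem_product] at hCD
    obtain ⟨⟨hC, -⟩, ⟨hD, -⟩⟩ := hCD
    ext v
    · simp only [Finset.mem_inter, Finset.mem_union]
      have := @hC v; have := @hD v; have := @hd v
      tauto
    · simp only [Finset.mem_inter, Finset.mem_union]
      have := @hC v; have := @hD v; have := @hd v
      tauto
  · intro C hC
    simp only [Finset.mem_filter, Finset.mem_powerset] at hC
    have h1 : (A ∪ B) \ C = (A \ (C ∩ A)) ∪ (B \ (C ∩ B)) := by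
      ext v
      simp only [Finset.mem_sdiff, Finset.mem_inter, Finset.mem_union]
      tauto
    have h2 : forestVal y t C = forestVal y t (C ∩ A) * forestVal y t (C ∩ B) := by
      rw [← (h.mono Finset.inter_subset_right Finset.inter_subset_right).forestVal_union, hS hC.1]
    rw [h1, (h.mono Finset.sdiff_subset Finset.sdiff_subset).forestVal_union, h2]
    ring

theorem exists_mem_tops (t : NAP I) {A : Finset I} (hA : A.Nonempty) : ∃ v, v ∈ t.tops A := by
  by_contra! hcon
  simp only [tops, Finset.mem_filter, not_and, not_or, not_not] at hcon
  obtain ⟨v, hv⟩ := hA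
  have hit : ∀ n, t.parent^[n] v ∈ A := by
    intro n
    induction n with
    | zero => exact hv
    | succ n ih =>
      rw [Function.iterate_succ_apply']
      exact (hcon _ ih).2
  obtain ⟨n, hn⟩ := t.reach v
  exact (hcon _ (hit n)).1 hn

theorem forestVal_ckConv [Finite I] (x y : RTree → R) (t : NAP I) (A : Finset I) :
    forestVal (RTree.ckConv x y) t A = forestConv x y t A := by
  induction A using Finset.strongInduction with
  | H A ih =>
    rcases A.eq_empty_or_nonempty with rfl | hne
    · rw [forestVal_empty, forestConv, Finset.powerset_empty, Finset.filter_singleton,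
        if_pos (by simp [LowerIn])]
      simp [forestVal_empty]
    · obtain ⟨v, hv⟩ := t.exists_mem_tops hne
      simp only [tops, Finset.mem_filter] at hv
      obtain ⟨hvA, hvt⟩ := hv
      set S := t.pieceSet (t.cutOf A) v with hS
      have hSA : ∀ w ∈ S, w ∈ A := pieceSet_cutOf_subset t A hvA
      set A1 := A.filter (· ∈ S) with hA1
      have hm : ∀ w, w ∈ A1 ↔ w ∈ S := fun w => by
        rw [hA1, Finset.mem_filter]
        exact ⟨fun h => h.2, fun h => ⟨hSA w h, h⟩⟩
      have hvS : v ∈ S := self_mem_pieceSet _ _ _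
      have hsep : t.Separated A1 (A \ A1) := by
        refine ⟨Finset.disjoint_sdiff, fun w hw hp => ?_, fun w hw hp => ?_⟩
        · rw [Finset.mem_sdiff, hm] at hp
          rw [hm] at hw
          by_cases hwv : w = v
          · subst hwv
            rcases hvt with h | h
            · rw [h, t.parent_root, ← h] at hp
              exact hp.2 hvS
            · exact h hp.1
          · exact hp.2 (parent_mem_pieceSet _ _ _ hw hwv)
        · rw [Finset.mem_sdiff, hm] at hw
          rw [hm] at hp
          refine hw.2 (mem_pieceSet_of_parent _ _ ?_ hp)
          simp only [cutOf, Set.mem_ofPred_eq, not_or, not_not]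
          exact ⟨hw.1, hSA _ hp⟩
      have hU : A1 ∪ (A \ A1) = A := Finset.union_sdiff_of_subset (Finset.filter_subset _ _)
      have hps : t.pieceSet (t.cutOf A1) v = S := by
        rw [← hsep.pieceSet_eq ((hm v).2 hvS), hU]
      have hlt : A \ A1 ⊂ A := by
        refine Finset.ssubset_iff_subset_ne.2 ⟨Finset.sdiff_subset, fun h => ?_⟩
        have := h ▸ hvA
        rw [Finset.mem_sdiff, hm] at this
        exact this.2 hvS
      have ht : t.tops A1 = {v} := by
        ext w
        simp only [tops, Finset.mem_filter, Finset.mem_singleton]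
        constructor
        · rintro ⟨h1, h2⟩
          by_contra hwv
          rw [hm] at h1 h2
          rcases h2 with h2 | h2
          · rw [h2] at h1
            exact hwv (h2.trans (root_mem_pieceSet _ _ _ h1).symm)
          · exact h2 (parent_mem_pieceSet _ _ _ h1 hwv)
        · rintro rfl
          exact ⟨(hm _).2 hvS, hvt.imp_right fun h h2 => h (hSA _ ((hm _).1 h2))⟩
      have h1 : forestVal (RTree.ckConv x y) t A1 = forestConv x y t A1 := by
        have hfin : Fintype (t.pieceSet (t.cutOf A1) v) := Fintype.ofFinite _
        have hf : IsEmb (t.piece (t.cutOf A1) v) t (Function.Embedding.subtype _) := by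
          refine ⟨fun u hu => coe_piece_parent_of_ne _ _ _ _ fun h => hu (Subtype.ext h), ?_⟩
          refine hvt.imp (fun h => h) ?_
          rintro h ⟨u, hu⟩
          apply h
          have hu' : t.parent v = u.1 := hu.symm
          rw [hu']
          exact hSA _ (hps ▸ u.2)
        rw [forestVal, ht, Finset.prod_singleton, ckConv_cls, ← hf.forestConv_map]
        congr 1
        ext w
        rw [hm, ← hps]
        simp
      rw [← hU, hsep.forestVal_union, hsep.forestConv_union, h1, ih _ hlt]

theorem forestConv_assoc [Fintype I] (x y z : RTree → R) (t : NAP I) :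
    forestConv (RTree.ckConv x y) z t Finset.univ =
      forestConv x (RTree.ckConv y z) t Finset.univ := by
  unfold forestConv
  simp only [forestVal_ckConv]
  unfold forestConv
  simp only [Finset.sum_mul, Finset.mul_sum]
  rw [Finset.sum_sigma', Finset.sum_sigma']
  refine Finset.sum_bij' (fun p _ => ⟨p.1 ∪ p.2, p.1⟩) (fun p _ => ⟨p.2, p.1 \ p.2⟩) ?_ ?_ ?_ ?_ ?_
  · rintro ⟨B, C⟩ h
    simp only [Finset.mem_sigma, Finset.mem_filter, Finset.mem_powerset, LowerIn,
      Finset.mem_univ, true_implies, Finset.mem_sdiff, true_and, Finset.mem_union] at h ⊢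
    obtain ⟨⟨-, hB⟩, hC, hCl⟩ := h
    refine ⟨⟨Finset.subset_univ _, fun v hv => ?_⟩, Finset.subset_union_left, fun v hv _ => hB v hv⟩
    rcases hv with hv | hv
    · exact Or.inl (hB v hv)
    · by_cases hp : t.parent v ∈ B
      · exact Or.inl hp
      · exact Or.inr (hCl v hv hp)
  · rintro ⟨B, C⟩ h
    simp only [Finset.mem_sigma, Finset.mem_filter, Finset.mem_powerset] at h ⊢
    simp only [LowerIn, Finset.mem_univ, true_implies, Finset.mem_sdiff] at h ⊢
    obtain ⟨⟨-, hB⟩, hC, hCl⟩ := h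
    refine ⟨⟨Finset.subset_univ _, fun v hv => hCl v hv (hB v (hC hv))⟩, Finset.sdiff_subset_sdiff (Finset.subset_univ _)
      (Finset.Subset.refl _), fun v hv hp => ⟨hB v hv.1, hp.2⟩⟩
  · rintro ⟨B, C⟩ h
    simp only [Finset.mem_sigma, Finset.mem_filter, Finset.mem_powerset] at h
    have hd : Disjoint B C := (Finset.subset_sdiff.1 h.2.1).2.symm
    simp only [Finset.union_sdiff_cancel_left hd]
  · rintro ⟨B, C⟩ h
    simp only [Finset.mem_sigma, Finset.mem_filter, Finset.mem_powerset] at h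
    simp only [Finset.union_sdiff_of_subset h.2.1]
  · rintro ⟨B, C⟩ h
    simp only [Finset.mem_sigma, Finset.mem_filter, Finset.mem_powerset] at h
    have hd : Disjoint B C := (Finset.subset_sdiff.1 h.2.1).2.symm
    have h1 : (Finset.univ \ B) \ C = Finset.univ \ (B ∪ C) := by
      ext v
      simp only [Finset.mem_sdiff, Finset.mem_univ, true_and, Finset.mem_union, not_or]
    rw [h1, Finset.union_sdiff_cancel_left hd]
    ring

end Forests

end NAP

namespace RTree

open NAP

variable {R : Type*} [CommRing R]

theorem ckConv_assoc (x y z : RTree → R) :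
    ckConv (ckConv x y) z = ckConv x (ckConv y z) := by
  funext T
  rw [ckConv_eq_forestConv_rep, ckConv_eq_forestConv_rep, forestConv_assoc]

theorem pieceSet_empty {I : Type} (t : NAP I) (w : I) : w ∈ t.pieceSet ∅ t.root := by
  obtain ⟨n, hn⟩ := t.reach w
  exact ⟨n, hn, fun _ _ h => h⟩

theorem zero_ckConv (y : RTree → R) : ckConv 0 y = y := by
  classical
  funext T
  have hmem : (∅ : Finset (Fin T.size)) ∈ Finset.univ.filter T.rep.IsAdmissibleCut := by
    simp [IsAdmissibleCut]
  unfold ckConv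
  rw [Finset.sum_eq_single_of_mem ∅ hmem]
  · simp only [Pi.zero_apply, zero_add, Finset.prod_empty, one_mul]
    rw [cls_piece_eq_self, cls_rep]
    intro w
    rw [Finset.coe_empty]
    exact pieceSet_empty _ _
  · intro c _ hc
    obtain ⟨v, hv⟩ := Finset.nonempty_iff_ne_empty.2 hc
    rw [Finset.prod_eq_zero hv rfl, zero_mul]

theorem ckConv_zero (x : RTree → R) : ckConv x 0 = x := by
  funext T
  simp [ckConv]

theorem size_piece_lt {T : RTree} {c : Finset (Fin T.size)} (hc : T.rep.IsAdmissibleCut c)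
    {v : Fin T.size} (hv : v ∈ c) : (T.rep.piece c v).cls.size < T.size := by
  classical
  rw [size_cls]
  have h : T.rep.root ∉ T.rep.pieceSet c v := fun h =>
    hc.1 (root_mem_pieceSet _ _ _ h ▸ hv)
  calc Nat.card (T.rep.pieceSet c v) < Nat.card (Fin T.size) := by
        rw [Nat.card_eq_fintype_card, Nat.card_eq_fintype_card]
        exact Fintype.card_subtype_lt (p := (· ∈ T.rep.pieceSet c v)) h
    _ = T.size := Nat.card_fin _

open Classical in
/-- The inverse for the convolution product, defined recursively. -/
noncomputable def ckInv (x : RTree → R) (T : RTree) : R :=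
  - ∑ c : Finset (Fin T.size) with T.rep.IsAdmissibleCut c,
    (∏ v ∈ c, if _h : (T.rep.piece c v).cls.size < T.size then ckInv x (T.rep.piece c v).cls else 0) *
      x (T.rep.piece c T.rep.root).cls
termination_by T.size

theorem ckInv_conv (x : RTree → R) : ckConv (ckInv x) x = 0 := by
  classical
  funext T
  rw [Pi.zero_apply, ckConv, ckInv, neg_add_eq_zero]
  refine Finset.sum_congr rfl fun c hc => ?_
  simp only [Finset.mem_filter, Finset.mem_univ, true_and] at hc
  congr 1
  refine Finset.prod_congr rfl fun v hv => ?_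
  rw [dif_pos (size_piece_lt hc hv)]

end RTree

namespace RTree

variable {K A B : Type*} [CommRing K] [CommRing A] [CommRing B] [Algebra K A] [Algebra K B]

theorem map_ckConv (φ : A →ₐ[K] B) (x y : RTree → A) (T : RTree) :
    φ (ckConv x y T) = ckConv (fun S => φ (x S)) (fun S => φ (y S)) T := by
  simp only [ckConv, map_add, map_sum, map_mul, map_prod]

theorem map_seriesComp (φ : A →ₐ[K] B) (x y : RTree → A) (T : RTree) :
    φ (seriesComp x y T) = seriesComp (fun S => φ (x S)) (fun S => φ (y S)) T := by
  simp only [seriesComp, map_sum, map_mul, map_prod]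

theorem ckConv_inv (x : RTree → A) : ckConv x (ckInv x) = 0 := by
  have h : ckInv (ckInv x) = x := by
    calc ckInv (ckInv x) = ckConv (ckInv (ckInv x)) (ckConv (ckInv x) x) := by
          rw [ckInv_conv, ckConv_zero]
      _ = x := by rw [← ckConv_assoc, ckInv_conv, zero_ckConv]
  have h2 := ckInv_conv (ckInv x)
  rwa [h] at h2

theorem seriesComp_inv (x : RTree → A) (hx : x dot = 1) :
    seriesComp x (seriesInv x) = seriesOne := by
  have h : seriesInv (seriesInv x) = x := by
    calc seriesInv (seriesInv x) = seriesComp (seriesInv (seriesInv x)) (seriesComp (seriesInv x) x) := by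
          rw [seriesInv_comp x hx, seriesComp_one]
      _ = x := by
          rw [← seriesComp_assoc, seriesInv_comp _ (seriesInv_dot x hx), seriesOne_comp]
  have h2 := seriesInv_comp (seriesInv x) (seriesInv_dot x hx)
  rwa [h] at h2

section Generic

variable {H : Type*} [CommRing H] [Algebra K H]

theorem coassoc_of_ckConv (D : H →ₐ[K] H ⊗[K] H) (u : RTree → H)
    (hD : ∀ T, D (u T) = ckConv (fun S => u S ⊗ₜ[K] (1 : H)) (fun S => (1 : H) ⊗ₜ[K] u S) T)
    (T : RTree) :
    ((Algebra.TensorProduct.assoc K K K H H H).toAlgHom.comp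
      ((Algebra.TensorProduct.map D (.id K H)).comp D)) (u T) =
    ((Algebra.TensorProduct.map (.id K H) D).comp D) (u T) := by
  have h1 : ∀ S, (Algebra.TensorProduct.assoc K K K H H H) (D (u S) ⊗ₜ[K] (1 : H)) =
      ckConv (fun S => u S ⊗ₜ[K] ((1 : H) ⊗ₜ[K] (1 : H)))
        (fun S => (1 : H) ⊗ₜ[K] (u S ⊗ₜ[K] (1 : H))) S := by
    intro S
    rw [hD]
    exact map_ckConv ((Algebra.TensorProduct.assoc K K K H H H).toAlgHom.comp
      Algebra.TensorProduct.includeLeft) _ _ S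
  have h2 : ∀ S, ((1 : H) ⊗ₜ[K] D (u S)) =
      ckConv (fun S => (1 : H) ⊗ₜ[K] (u S ⊗ₜ[K] (1 : H)))
        (fun S => (1 : H) ⊗ₜ[K] ((1 : H) ⊗ₜ[K] u S)) S := by
    intro S
    rw [hD]
    exact map_ckConv (Algebra.TensorProduct.includeRight :
      H ⊗[K] H →ₐ[K] H ⊗[K] (H ⊗[K] H)) _ _ S
  rw [AlgHom.comp_apply, AlgHom.comp_apply, AlgHom.comp_apply, hD, map_ckConv, map_ckConv,
    map_ckConv]
  have e1 : ∀ S, (Algebra.TensorProduct.assoc K K K H H H).toAlgHom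
      ((Algebra.TensorProduct.map D (.id K H)) (u S ⊗ₜ[K] (1 : H))) =
      ckConv (fun S => u S ⊗ₜ[K] ((1 : H) ⊗ₜ[K] (1 : H)))
        (fun S => (1 : H) ⊗ₜ[K] (u S ⊗ₜ[K] (1 : H))) S := fun S => by
    rw [Algebra.TensorProduct.map_tmul]
    exact h1 S
  have e2 : ∀ S, (Algebra.TensorProduct.assoc K K K H H H).toAlgHom
      ((Algebra.TensorProduct.map D (.id K H)) ((1 : H) ⊗ₜ[K] u S)) =
      (1 : H) ⊗ₜ[K] ((1 : H) ⊗ₜ[K] u S) := fun S => by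
    rw [Algebra.TensorProduct.map_tmul, map_one]
    rfl
  have e3 : ∀ S, (Algebra.TensorProduct.map (.id K H) D) (u S ⊗ₜ[K] (1 : H)) =
      u S ⊗ₜ[K] ((1 : H) ⊗ₜ[K] (1 : H)) := fun S => by
    rw [Algebra.TensorProduct.map_tmul, map_one]
    rfl
  have e4 : ∀ S, (Algebra.TensorProduct.map (.id K H) D) ((1 : H) ⊗ₜ[K] u S) =
      ckConv (fun S => (1 : H) ⊗ₜ[K] (u S ⊗ₜ[K] (1 : H)))
        (fun S => (1 : H) ⊗ₜ[K] ((1 : H) ⊗ₜ[K] u S)) S := fun S => by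
    rw [Algebra.TensorProduct.map_tmul]
    exact h2 S
  simp only [e1, e2, e3, e4]
  exact congrFun (ckConv_assoc _ _ _) T

theorem rTensor_of_ckConv (D : H →ₐ[K] H ⊗[K] H) (ε : H →ₐ[K] K) (u : RTree → H)
    (hD : ∀ T, D (u T) = ckConv (fun S => u S ⊗ₜ[K] (1 : H)) (fun S => (1 : H) ⊗ₜ[K] u S) T)
    (hε : ∀ T, ε (u T) = 0) (T : RTree) :
    ((Algebra.TensorProduct.map ε (.id K H)).comp D) (u T) =
      (Algebra.TensorProduct.lid K H).symm (u T) := by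
  rw [AlgHom.comp_apply, hD, map_ckConv]
  simp only [Algebra.TensorProduct.map_tmul, AlgHom.id_apply, map_one, hε,
    TensorProduct.zero_tmul]
  exact congrFun (zero_ckConv _) T

theorem lTensor_of_ckConv (D : H →ₐ[K] H ⊗[K] H) (ε : H →ₐ[K] K) (u : RTree → H)
    (hD : ∀ T, D (u T) = ckConv (fun S => u S ⊗ₜ[K] (1 : H)) (fun S => (1 : H) ⊗ₜ[K] u S) T)
    (hε : ∀ T, ε (u T) = 0) (T : RTree) :
    ((Algebra.TensorProduct.map (.id K H) ε).comp D) (u T) =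
      (Algebra.TensorProduct.rid K K H).symm (u T) := by
  rw [AlgHom.comp_apply, hD, map_ckConv]
  simp only [Algebra.TensorProduct.map_tmul, AlgHom.id_apply, map_one, hε,
    TensorProduct.tmul_zero]
  exact congrFun (ckConv_zero _) T

theorem lift_of_ckConv (D : H →ₐ[K] H ⊗[K] H) (u x y : RTree → H) (φ ψ : H →ₐ[K] H)
    (hD : ∀ T, D (u T) = ckConv (fun S => u S ⊗ₜ[K] (1 : H)) (fun S => (1 : H) ⊗ₜ[K] u S) T)
    (hφ : ∀ T, φ (u T) = x T) (hψ : ∀ T, ψ (u T) = y T) (T : RTree) :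
    (Algebra.TensorProduct.lift φ ψ fun _ _ => Commute.all _ _) (D (u T)) = ckConv x y T := by
  rw [hD, map_ckConv]
  simp only [Algebra.TensorProduct.lift_tmul, map_one, mul_one, one_mul, hφ, hψ]

theorem map_seriesOne (φ : A →ₐ[K] B) (T : RTree) : φ (seriesOne T) = seriesOne T := by
  unfold seriesOne
  split_ifs <;> simp

theorem coassoc_of_seriesComp (D : H →ₐ[K] H ⊗[K] H) (u : RTree → H)
    (hD : ∀ T, D (u T) = seriesComp (fun S => (1 : H) ⊗ₜ[K] u S) (fun S => u S ⊗ₜ[K] (1 : H)) T)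
    (T : RTree) :
    ((Algebra.TensorProduct.assoc K K K H H H).toAlgHom.comp
      ((Algebra.TensorProduct.map D (.id K H)).comp D)) (u T) =
    ((Algebra.TensorProduct.map (.id K H) D).comp D) (u T) := by
  have h1 : ∀ S, (Algebra.TensorProduct.assoc K K K H H H) (D (u S) ⊗ₜ[K] (1 : H)) =
      seriesComp (fun S => (1 : H) ⊗ₜ[K] (u S ⊗ₜ[K] (1 : H)))
        (fun S => u S ⊗ₜ[K] ((1 : H) ⊗ₜ[K] (1 : H))) S := by
    intro S
    rw [hD]
    exact map_seriesComp ((Algebra.TensorProduct.assoc K K K H H H).toAlgHom.comp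
      Algebra.TensorProduct.includeLeft) _ _ S
  have h2 : ∀ S, ((1 : H) ⊗ₜ[K] D (u S)) =
      seriesComp (fun S => (1 : H) ⊗ₜ[K] ((1 : H) ⊗ₜ[K] u S))
        (fun S => (1 : H) ⊗ₜ[K] (u S ⊗ₜ[K] (1 : H))) S := by
    intro S
    rw [hD]
    exact map_seriesComp (Algebra.TensorProduct.includeRight :
      H ⊗[K] H →ₐ[K] H ⊗[K] (H ⊗[K] H)) _ _ S
  rw [AlgHom.comp_apply, AlgHom.comp_apply, AlgHom.comp_apply, hD, map_seriesComp,
    map_seriesComp, map_seriesComp]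
  have e1 : ∀ S, (Algebra.TensorProduct.assoc K K K H H H).toAlgHom
      ((Algebra.TensorProduct.map D (.id K H)) (u S ⊗ₜ[K] (1 : H))) =
      seriesComp (fun S => (1 : H) ⊗ₜ[K] (u S ⊗ₜ[K] (1 : H)))
        (fun S => u S ⊗ₜ[K] ((1 : H) ⊗ₜ[K] (1 : H))) S := fun S => by
    rw [Algebra.TensorProduct.map_tmul]
    exact h1 S
  have e2 : ∀ S, (Algebra.TensorProduct.assoc K K K H H H).toAlgHom
      ((Algebra.TensorProduct.map D (.id K H)) ((1 : H) ⊗ₜ[K] u S)) =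
      (1 : H) ⊗ₜ[K] ((1 : H) ⊗ₜ[K] u S) := fun S => by
    rw [Algebra.TensorProduct.map_tmul, map_one]
    rfl
  have e3 : ∀ S, (Algebra.TensorProduct.map (.id K H) D) (u S ⊗ₜ[K] (1 : H)) =
      u S ⊗ₜ[K] ((1 : H) ⊗ₜ[K] (1 : H)) := fun S => by
    rw [Algebra.TensorProduct.map_tmul, map_one]
    rfl
  have e4 : ∀ S, (Algebra.TensorProduct.map (.id K H) D) ((1 : H) ⊗ₜ[K] u S) =
      seriesComp (fun S => (1 : H) ⊗ₜ[K] ((1 : H) ⊗ₜ[K] u S))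
        (fun S => (1 : H) ⊗ₜ[K] (u S ⊗ₜ[K] (1 : H))) S := fun S => by
    rw [Algebra.TensorProduct.map_tmul]
    exact h2 S
  simp only [e1, e2, e3, e4]
  exact (congrFun (seriesComp_assoc _ _ _) T).symm

theorem rTensor_of_seriesComp (D : H →ₐ[K] H ⊗[K] H) (ε : H →ₐ[K] K) (u : RTree → H)
    (hD : ∀ T, D (u T) = seriesComp (fun S => (1 : H) ⊗ₜ[K] u S) (fun S => u S ⊗ₜ[K] (1 : H)) T)
    (hε : ∀ T, ε (u T) = seriesOne T) (T : RTree) :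
    ((Algebra.TensorProduct.map ε (.id K H)).comp D) (u T) =
      (Algebra.TensorProduct.lid K H).symm (u T) := by
  rw [AlgHom.comp_apply, hD, map_seriesComp]
  have h : (fun S => (seriesOne S : K) ⊗ₜ[K] (1 : H)) = seriesOne :=
    funext fun S => map_seriesOne (Algebra.TensorProduct.includeLeft : K →ₐ[K] K ⊗[K] H) S
  simp only [Algebra.TensorProduct.map_tmul, AlgHom.id_apply, map_one, hε]
  rw [h, seriesComp_one]
  rfl

theorem lTensor_of_seriesComp (D : H →ₐ[K] H ⊗[K] H) (ε : H →ₐ[K] K) (u : RTree → H)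
    (hD : ∀ T, D (u T) = seriesComp (fun S => (1 : H) ⊗ₜ[K] u S) (fun S => u S ⊗ₜ[K] (1 : H)) T)
    (hε : ∀ T, ε (u T) = seriesOne T) (T : RTree) :
    ((Algebra.TensorProduct.map (.id K H) ε).comp D) (u T) =
      (Algebra.TensorProduct.rid K K H).symm (u T) := by
  rw [AlgHom.comp_apply, hD, map_seriesComp]
  have h : (fun S => (1 : H) ⊗ₜ[K] (seriesOne S : K)) = seriesOne :=
    funext fun S => map_seriesOne (Algebra.TensorProduct.includeRight : K →ₐ[K] H ⊗[K] K) S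
  simp only [Algebra.TensorProduct.map_tmul, AlgHom.id_apply, map_one, hε]
  rw [h, seriesOne_comp]
  rfl

theorem lift_of_seriesComp (D : H →ₐ[K] H ⊗[K] H) (u x y : RTree → H) (φ ψ : H →ₐ[K] H)
    (hD : ∀ T, D (u T) = seriesComp (fun S => (1 : H) ⊗ₜ[K] u S) (fun S => u S ⊗ₜ[K] (1 : H)) T)
    (hφ : ∀ T, φ (u T) = x T) (hψ : ∀ T, ψ (u T) = y T) (T : RTree) :
    (Algebra.TensorProduct.lift φ ψ fun _ _ => Commute.all _ _) (D (u T)) = seriesComp y x T := by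
  rw [hD, map_seriesComp]
  simp only [Algebra.TensorProduct.lift_tmul, map_one, mul_one, one_mul, hφ, hψ]

end Generic

end RTree

/-- The algebra of the Connes–Kreimer Hopf algebra: the free commutative algebra
`Sym (𝕂 T)` on the set of rooted trees. -/
def HCK (K : Type*) [CommRing K] : Type _ := MvPolynomial RTree K

namespace HCK

variable (K : Type*) [CommRing K]

noncomputable instance : CommRing (HCK K) := inferInstanceAs (CommRing (MvPolynomial RTree K))

noncomputable instance : Algebra K (HCK K) := inferInstanceAs (Algebra K (MvPolynomial RTree K))

variable {K}

/-- A rooted tree as an element of the Connes–Kreimer Hopf algebra. -/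
noncomputable def tree (T : RTree) : HCK K := (MvPolynomial.X T : MvPolynomial RTree K)

/-- The algebra morphism with prescribed values on rooted trees. -/
noncomputable def lift {A : Type*} [CommRing A] [Algebra K A] (x : RTree → A) : HCK K →ₐ[K] A :=
  (MvPolynomial.aeval x : MvPolynomial RTree K →ₐ[K] A)

@[simp]
theorem lift_tree {A : Type*} [CommRing A] [Algebra K A] (x : RTree → A) (T : RTree) :
    lift x (tree T : HCK K) = x T :=
  MvPolynomial.aeval_X (R := K) x T

theorem algHom_ext {A : Type*} [CommRing A] [Algebra K A] {φ ψ : HCK K →ₐ[K] A}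
    (h : ∀ T, φ (tree T) = ψ (tree T)) : φ = ψ :=
  MvPolynomial.algHom_ext (R := K) (σ := RTree) h

variable (K)

open Classical in
/-- The coproduct: the algebra morphism with
`Δ(T) = T ⊗ 1 + ∑_c P_c(T) ⊗ R_c(T)`, the sum being over all admissible cuts `c` of `T`
(the empty cut giving the term `1 ⊗ T`). -/
noncomputable def comulHom : HCK K →ₐ[K] HCK K ⊗[K] HCK K :=
  lift fun T => tree T ⊗ₜ 1 + ∑ c : Finset (Fin T.size) with T.rep.IsAdmissibleCut c,
    (∏ v ∈ c, tree (T.rep.piece c v).cls) ⊗ₜ tree (T.rep.piece c T.rep.root).cls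

/-- The counit: the algebra morphism vanishing on all rooted trees. -/
noncomputable def counitHom : HCK K →ₐ[K] K := lift fun _ => 0

variable {K}

theorem comulHom_tree (T : RTree) : comulHom K (tree T) =
    RTree.ckConv (fun S => (tree S : HCK K) ⊗ₜ[K] (1 : HCK K)) (fun S => 1 ⊗ₜ tree S) T := by
  rw [comulHom, lift_tree, RTree.ckConv]
  congr 1
  refine Finset.sum_congr rfl fun c _ => ?_
  have h := map_prod (Algebra.TensorProduct.includeLeft : HCK K →ₐ[K] HCK K ⊗[K] HCK K)
    (fun v => tree (T.rep.piece c v).cls) c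
  simp only [Algebra.TensorProduct.includeLeft_apply] at h
  rw [← h, Algebra.TensorProduct.tmul_mul_tmul, mul_one, one_mul]

theorem counitHom_tree (T : RTree) : counitHom K (tree T) = 0 := lift_tree _ T

noncomputable instance : Bialgebra K (HCK K) :=
  Bialgebra.ofAlgHom (comulHom K) (counitHom K)
    (algHom_ext (RTree.coassoc_of_ckConv (comulHom K) tree comulHom_tree))
    (algHom_ext (RTree.rTensor_of_ckConv (comulHom K) (counitHom K) tree comulHom_tree
      counitHom_tree))
    (algHom_ext (RTree.lTensor_of_ckConv (comulHom K) (counitHom K) tree comulHom_tree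
      counitHom_tree))

/-- The Connes–Kreimer Hopf algebra of rooted trees. -/
noncomputable instance : HopfAlgebra K (HCK K) :=
  HopfAlgebra.ofAlgHom (lift (RTree.ckInv tree))
    (algHom_ext fun T => by
      refine (RTree.lift_of_ckConv (comulHom K) tree _ _ _ _ comulHom_tree (lift_tree _)
        (fun _ => rfl) T).trans ?_
      refine (congrFun (RTree.ckInv_conv _) T).trans ?_
      refine Eq.symm ?_
      refine (congrArg (Algebra.ofId K (HCK K)) (counitHom_tree T)).trans ?_
      exact map_zero _)
    (algHom_ext fun T => by
      refine (RTree.lift_of_ckConv (comulHom K) tree _ _ _ _ comulHom_tree (fun _ => rfl)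
        (lift_tree _) T).trans ?_
      refine (congrFun (RTree.ckConv_inv _) T).trans ?_
      refine Eq.symm ?_
      refine (congrArg (Algebra.ofId K (HCK K)) (counitHom_tree T)).trans ?_
      exact map_zero _)

end HCK

/-- The set `G_NAP` of all formal series `∑_T x_T T` in `∏ n, 𝕂 (NAP_n)_{S_n}` whose first component
is the unit `•`. -/
@[ext]
structure GNAP (K : Type*) [CommRing K] where
  coeff : RTree → K
  coeff_dot : coeff RTree.dot = 1

namespace GNAP

variable {K : Type*} [CommRing K]

/-- The group structure of `G_NAP` given by the composition of series induced by the operad: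
`x * y` is the series obtained by substituting `x` into `y`. (The order of the factors is the one
for which the coproduct of coordinate functions, `Δ(h)(x, y) = h(x * y)`, has the trees substituted
on the left, as the branches are in the Connes–Kreimer coproduct.) -/
noncomputable instance : Group (GNAP K) where
  mul x y := ⟨RTree.seriesComp y.coeff x.coeff, by
    rw [RTree.seriesComp_dot, x.coeff_dot, y.coeff_dot, mul_one]⟩
  one := ⟨RTree.seriesOne, RTree.seriesOne_dot⟩
  inv x := ⟨RTree.seriesInv x.coeff, RTree.seriesInv_dot _ x.coeff_dot⟩
  mul_assoc x y z := GNAP.ext (RTree.seriesComp_assoc _ _ _).symm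
  one_mul x := GNAP.ext (RTree.seriesComp_one _)
  mul_one x := GNAP.ext (RTree.seriesOne_comp _)
  inv_mul_cancel x := GNAP.ext (RTree.seriesComp_inv _ x.coeff_dot)

theorem coeff_mul (x y : GNAP K) : (x * y).coeff = RTree.seriesComp y.coeff x.coeff := rfl

end GNAP

/-- The algebra `𝕂[G_NAP]` of polynomial functions on `G_NAP`: the free commutative algebra on the
coordinate functions `g_T`, for `T` a rooted tree different from `•`. -/
def CoordNAP (K : Type*) [CommRing K] : Type _ := MvPolynomial {T : RTree // T ≠ RTree.dot} K

namespace CoordNAP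

variable (K : Type*) [CommRing K]

noncomputable instance : CommRing (CoordNAP K) :=
  inferInstanceAs (CommRing (MvPolynomial {T : RTree // T ≠ RTree.dot} K))

noncomputable instance : Algebra K (CoordNAP K) :=
  inferInstanceAs (Algebra K (MvPolynomial {T : RTree // T ≠ RTree.dot} K))

variable {K}

open Classical in
/-- The coordinate function `g_T`, with `g_• = 1`. -/
noncomputable def g (T : RTree) : CoordNAP K :=
  if h : T = RTree.dot then 1
  else (MvPolynomial.X ⟨T, h⟩ : MvPolynomial {T : RTree // T ≠ RTree.dot} K)

/-- The algebra morphism with prescribed values on the `g_T`, `T ≠ •`. -/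
noncomputable def lift {A : Type*} [CommRing A] [Algebra K A] (x : RTree → A) :
    CoordNAP K →ₐ[K] A :=
  (MvPolynomial.aeval fun T => x T.1 : MvPolynomial {T : RTree // T ≠ RTree.dot} K →ₐ[K] A)

theorem g_dot : (g RTree.dot : CoordNAP K) = 1 := by simp [g]

theorem g_of_ne {T : RTree} (h : T ≠ RTree.dot) : (g T : CoordNAP K) =
    (MvPolynomial.X ⟨T, h⟩ : MvPolynomial {T : RTree // T ≠ RTree.dot} K) :=
  dif_neg h

theorem lift_g {A : Type*} [CommRing A] [Algebra K A] (x : RTree → A) (hx : x RTree.dot = 1)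
    (T : RTree) : lift x (g T : CoordNAP K) = x T := by
  by_cases h : T = RTree.dot
  · rw [h, g_dot, map_one, hx]
  · rw [g_of_ne h]
    exact MvPolynomial.aeval_X (R := K) (fun T : {T : RTree // T ≠ RTree.dot} => x T.1) ⟨T, h⟩

theorem algHom_ext {A : Type*} [CommRing A] [Algebra K A] {φ ψ : CoordNAP K →ₐ[K] A}
    (h : ∀ T, φ (g T) = ψ (g T)) : φ = ψ := by
  refine MvPolynomial.algHom_ext (R := K) (σ := {T : RTree // T ≠ RTree.dot}) fun T => ?_
  have := h T.1
  rwa [g_of_ne T.2] at this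

variable (K)

/-- The coproduct dual to the product of `G_NAP`: the algebra morphism with
`Δ(g_T) = ∑ (g_{s 1} ⋯ g_{s n}) ⊗ g_α`, the sum being over all ways to write
`T = α (s 1, …, s n)`. -/
noncomputable def comulHom : CoordNAP K →ₐ[K] CoordNAP K ⊗[K] CoordNAP K :=
  lift fun T => ∑ p ∈ T.decomp, (∏ i, g (p.2 i)) ⊗ₜ g p.1

/-- The counit: evaluation at the unit series `•`. -/
noncomputable def counitHom : CoordNAP K →ₐ[K] K := lift fun _ => 0

variable {K}

theorem comulHom_aux (T : RTree) :
    ∑ p ∈ T.decomp, ((∏ i, g (p.2 i) : CoordNAP K)) ⊗ₜ[K] (g p.1 : CoordNAP K) =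
    RTree.seriesComp (fun S => (1 : CoordNAP K) ⊗ₜ[K] (g S : CoordNAP K)) (fun S => g S ⊗ₜ 1) T := by
  unfold RTree.seriesComp
  refine Finset.sum_congr rfl fun p _ => ?_
  have h := map_prod (Algebra.TensorProduct.includeLeft :
    CoordNAP K →ₐ[K] CoordNAP K ⊗[K] CoordNAP K) (fun i => g (p.2 i)) Finset.univ
  simp only [Algebra.TensorProduct.includeLeft_apply] at h
  rw [← h, Algebra.TensorProduct.tmul_mul_tmul, mul_one, one_mul]

theorem comulHom_g (T : RTree) : comulHom K (g T) =
    RTree.seriesComp (fun S => (1 : CoordNAP K) ⊗ₜ[K] (g S : CoordNAP K)) (fun S => g S ⊗ₜ 1) T := by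
  rw [comulHom, lift_g, comulHom_aux]
  rw [comulHom_aux, RTree.seriesComp_dot, g_dot, ← Algebra.TensorProduct.one_def, mul_one]

theorem counitHom_g (T : RTree) : counitHom K (g T) = RTree.seriesOne T := by
  by_cases h : T = RTree.dot
  · rw [h, g_dot, map_one, RTree.seriesOne_dot]
  · rw [g_of_ne h]
    refine (MvPolynomial.aeval_X (R := K) _ _).trans ?_
    simp [RTree.seriesOne, h]

noncomputable instance : Bialgebra K (CoordNAP K) :=
  Bialgebra.ofAlgHom (comulHom K) (counitHom K)
    (algHom_ext (RTree.coassoc_of_seriesComp (comulHom K) g comulHom_g))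
    (algHom_ext (RTree.rTensor_of_seriesComp (comulHom K) (counitHom K) g comulHom_g counitHom_g))
    (algHom_ext (RTree.lTensor_of_seriesComp (comulHom K) (counitHom K) g comulHom_g counitHom_g))

/-- The Hopf algebra `𝕂[G_NAP]` of coordinate functions on `G_NAP`. -/
noncomputable instance : HopfAlgebra K (CoordNAP K) :=
  HopfAlgebra.ofAlgHom (lift (RTree.seriesInv g))
    (algHom_ext fun T => by
      refine (RTree.lift_of_seriesComp (comulHom K) g _ _ _ _ comulHom_g
        (lift_g _ (RTree.seriesInv_dot _ g_dot)) (fun _ => rfl) T).trans ?_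
      refine (congrFun (RTree.seriesComp_inv _ g_dot) T).trans ?_
      refine Eq.symm ?_
      refine (congrArg (Algebra.ofId K (CoordNAP K)) (counitHom_g T)).trans ?_
      exact RTree.map_seriesOne (Algebra.ofId K (CoordNAP K)) T)
    (algHom_ext fun T => by
      refine (RTree.lift_of_seriesComp (comulHom K) g _ _ _ _ comulHom_g (fun _ => rfl)
        (lift_g _ (RTree.seriesInv_dot _ g_dot)) T).trans ?_
      refine (congrFun (RTree.seriesInv_comp _ g_dot) T).trans ?_
      refine Eq.symm ?_
      refine (congrArg (Algebra.ofId K (CoordNAP K)) (counitHom_g T)).trans ?_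
      exact RTree.map_seriesOne (Algebra.ofId K (CoordNAP K)) T)

end CoordNAP

/-! The morphism is `φ(g_T) = B₋(T) / |Aut T|`, where `B₋(T)` is the forest of branches of the root
of `T`, a monomial in `HCK`. In terms of series, a function `x` on trees, extended multiplicatively
to forests, gives the branch series `∑_T x(B₋(T)) / |Aut T| · T` (`branchSeries`). Everything
reduces to one identity, `seriesComp_branchSeries`: substituting the branch series of `x` into that
of `y` gives the branch series of the Connes–Kreimer convolution `ckConv x y`.

To prove it, multiply the coefficient at `T` by `|Aut T|`. The sum over the pairs `(α, s)` with
`α(s) = T` becomes a sum over all pairs, weighted by the number of isomorphisms from `α(s)` to `T`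
(`autCard_mul_sum_decomp`). Such an isomorphism amounts to an embedding of `α` in `T` preserving the
root, which gives the roots of the inner trees, together with isomorphisms from the `s_i` onto the
blocks into which the image vertices cut `T` (`card_iso_comp`). The factors `1 / |Aut s_i|` and `1 /
|Aut α|` then cancel the choices of isomorphisms (`sum_card_iso`, `sum_rootedEmb`). What is left is
a sum over the subtrees `S` of `T` containing the root: the product of the values of `x` on the
branches of the blocks, times the value of `y` on the branches of `S`. The branches of the blocks
form the forest outside `S`, and `S` without the root is a lower part of `B₋(T)`. Thus the sum is
the convolution evaluated on `B₋(T)` (`branchVal_ckConv`).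

The identity holds over any commutative `𝕂`-algebra. Over `HCK ⊗ HCK`, with `x = T ⊗ 1` and `y = 1 ⊗
T`, it is compatibility with coproducts; over `𝕂` it is multiplicativity of the map on characters.
Surjectivity comes from grafting: a tree `T` is the only branch of the tree obtained by putting a
new root below it. Injectivity on characters follows, since a character is determined by its
composite with a surjection. -/

namespace NAP

/-! ### Blocks of a tree cut at a set of vertices; counting isomorphisms. -/

variable {I J V : Type}

/-- When the base points lie in `c`, the block of `w` is that of the first vertex of `c` met on the
way from `w` to the root. -/
theorem mem_pieceSet_unique (t : NAP V) {c : Set V} {r r' w : V} (hr : r ∈ c) (hr' : r' ∈ c)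
    (h : w ∈ t.pieceSet c r) (h' : w ∈ t.pieceSet c r') : r = r' := by
  obtain ⟨n, hn, hk⟩ := h
  obtain ⟨m, hm, hk'⟩ := h'
  rcases lt_trichotomy n m with hlt | rfl | hlt
  · exact absurd (hn ▸ hr) (hk' n hlt)
  · exact hn.symm.trans hm
  · exact absurd (hm ▸ hr') (hk m hlt)

theorem exists_mem_pieceSet (t : NAP V) {c : Set V} (hc : t.root ∈ c) (w : V) :
    ∃ r ∈ c, w ∈ t.pieceSet c r := by
  classical
  have h : ∃ n, t.parent^[n] w ∈ c := by
    obtain ⟨n, hn⟩ := t.reach w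
    exact ⟨n, hn ▸ hc⟩
  exact ⟨_, Nat.find_spec h, Nat.find h, rfl, fun k hk => Nat.find_min h hk⟩

/-- The isomorphisms between two rooted trees. -/
abbrev Iso (s : NAP I) (t : NAP J) : Type :=
  {e : I ≃ J // ∀ v, e (s.parent v) = t.parent (e v)}

/-- The embeddings of a rooted tree as a subtree containing the root. -/
abbrev RootedEmb (s : NAP I) (t : NAP J) : Type :=
  {f : I ↪ J // ∀ v, f (s.parent v) = t.parent (f v)}

noncomputable instance [Finite I] [Finite J] (s : NAP I) (t : NAP J) : Fintype (RootedEmb s t) :=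
  Fintype.ofFinite _

theorem RootedEmb.map_root {s : NAP I} {t : NAP J} (f : RootedEmb s t) :
    f.1 s.root = t.root :=
  t.eq_root_of_parent (by rw [← f.2, s.parent_root])

theorem RootedEmb.isEmb {s : NAP I} {t : NAP J} (f : RootedEmb s t) : IsEmb s t f.1 :=
  ⟨fun u _ => f.2 u, Or.inl f.map_root⟩

theorem Iso.map_root {s : NAP I} {t : NAP J} (e : Iso s t) : e.1 s.root = t.root :=
  root_of_equiv e.1 e.2

theorem Iso.cls_eq [Finite I] [Finite J] {s : NAP I} {t : NAP J} (e : Iso s t) : s.cls = t.cls :=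
  cls_eq_of_equiv e.1 e.2

/-- The number of automorphisms of a rooted tree. -/
noncomputable def _root_.RTree.autCard (T : RTree) : ℕ := Nat.card (Iso T.rep T.rep)

/-- Composition of isomorphisms, as a bijection between sets of isomorphisms. -/
def Iso.congr {I' J' : Type} {s : NAP I} {t : NAP J} {s' : NAP I'} {t' : NAP J'} (a : Iso s s')
    (b : Iso t t') : Iso s t ≃ Iso s' t' where
  toFun e := ⟨(a.1.symm.trans e.1).trans b.1, fun v => by
    obtain ⟨u, rfl⟩ := a.1.surjective v
    simp [← a.2, e.2, b.2]⟩
  invFun e := ⟨(a.1.trans e.1).trans b.1.symm, fun v => by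
    apply b.1.injective
    simp [a.2, e.2, b.2]⟩
  left_inv e := Subtype.ext (by ext; simp)
  right_inv e := Subtype.ext (by ext; simp)

open Classical in
-- Once both trees are identified with the chosen representative of their common class, isomorphisms
-- between them become its automorphisms.
theorem card_iso [Finite I] [Finite J] (s : NAP I) (t : NAP J) :
    Nat.card (Iso s t) = if s.cls = t.cls then s.cls.autCard else 0 := by
  split_ifs with h
  · obtain ⟨e, -, he⟩ := RTree.exists_equiv_rep s
    obtain ⟨f, -, hf⟩ := exists_equiv_of_cls_eq (h.symm.trans (RTree.cls_rep s.cls).symm)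
    exact Nat.card_congr (Iso.congr ⟨e, he⟩ ⟨f, hf⟩)
  · rw [Nat.card_eq_zero]
    exact Or.inl ⟨fun e => h e.cls_eq⟩

theorem _root_.RTree.autCard_ne_zero (T : RTree) : T.autCard ≠ 0 := by
  have : Nonempty (Iso T.rep T.rep) := ⟨⟨Equiv.refl _, fun _ => rfl⟩⟩
  exact Nat.card_pos.ne'

/-! ### Isomorphisms from a composition onto a tree. -/

section Decomposition

variable {L : I → Type} {a : NAP I} {s : ∀ i, NAP (L i)} {t : NAP V}

/-- The embedding given by the roots of the inner trees of a composition. -/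
def Iso.rootEmb (e : Iso (a.comp s) t) : RootedEmb a t :=
  ⟨⟨fun i => e.1 ⟨i, (s i).root⟩, fun i j h => congrArg Sigma.fst (e.1.injective h)⟩, fun i => by
    have := e.2 ⟨i, (s i).root⟩
    rwa [comp_parent_root] at this⟩

/-- Inside an inner tree, only the edge leaving its root is cut: going down from `j`, no earlier
vertex is sent to the image of an inner root. -/
theorem Iso.mem_pieceSet (e : Iso (a.comp s) t) (i : I) (j : L i) :
    e.1 ⟨i, j⟩ ∈ t.pieceSet (Set.range e.rootEmb.1) (e.rootEmb.1 i) := by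
  obtain ⟨n, hn⟩ := (s i).reach j
  induction n generalizing j with
  | zero =>
    obtain rfl : j = (s i).root := hn
    exact self_mem_pieceSet _ _ _
  | succ n ih =>
    by_cases hj : j = (s i).root
    · subst hj
      exact self_mem_pieceSet _ _ _
    · refine mem_pieceSet_of_parent _ _ ?_ ?_
      · rintro ⟨k, hk⟩
        have h := e.1.injective hk
        obtain ⟨rfl, h⟩ := Sigma.mk.inj_iff.1 h
        exact hj (eq_of_heq h).symm
      · rw [← e.2, comp_parent_of_ne _ _ _ _ hj]
        exact ih _ hn

/-- The isomorphisms from the inner trees of a composition to the blocks of its image. -/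
noncomputable def Iso.block (e : Iso (a.comp s) t) (i : I) :
    Iso (s i) (t.piece (Set.range e.rootEmb.1) (e.rootEmb.1 i)) :=
  ⟨Equiv.ofBijective (fun j => ⟨e.1 ⟨i, j⟩, e.mem_pieceSet i j⟩) (by
    constructor
    · intro j k h
      have h2 := e.1.injective (congrArg Subtype.val h)
      exact eq_of_heq (Sigma.mk.inj_iff.1 h2).2
    · rintro ⟨w, hw⟩
      obtain ⟨⟨i', j⟩, rfl⟩ := e.1.surjective w
      -- A vertex of this block coming from the inner tree `i'` also lies in the block of `i'`, so
      -- the two blocks coincide.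
      have h := mem_pieceSet_unique t (Set.mem_range_self i) (Set.mem_range_self i') hw (e.mem_pieceSet i' j)
      obtain rfl := e.rootEmb.1.injective h
      exact ⟨j, rfl⟩), fun j => by
    by_cases hj : j = (s i).root
    · subst hj
      rw [parent_root, piece_parent_of_eq]
      rfl
    · apply Subtype.ext
      rw [coe_piece_parent_of_ne]
      · change e.1 ⟨i, (s i).parent j⟩ = t.parent (e.1 ⟨i, j⟩)
        rw [← e.2, comp_parent_of_ne _ _ _ _ hj]
      · intro h
        have h2 := e.1.injective h
        exact hj (eq_of_heq (Sigma.mk.inj_iff.1 h2).2)⟩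

/-- The isomorphism from a composition assembled from isomorphisms onto the blocks. -/
noncomputable def Iso.ofBlocks (f : RootedEmb a t)
    (d : ∀ i, Iso (s i) (t.piece (Set.range f.1) (f.1 i))) : Iso (a.comp s) t :=
  ⟨Equiv.ofBijective (fun p => ((d p.1).1 p.2).1) (by
    constructor
    · rintro ⟨i, j⟩ ⟨i', j'⟩ h
      have h1 := ((d i).1 j).2
      have h2 := ((d i').1 j').2
      dsimp only at h
      rw [← h] at h2
      obtain rfl := f.1.injective (mem_pieceSet_unique t (Set.mem_range_self i) (Set.mem_range_self i') h1 h2)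
      rw [(d i).1.injective (Subtype.ext h)]
    · intro w
      -- The blocks cover `t` because the root of `t` is among the base points.
      obtain ⟨_, ⟨i, rfl⟩, hw⟩ := t.exists_mem_pieceSet (c := Set.range f.1) ⟨a.root, f.map_root⟩ w
      exact ⟨⟨i, (d i).1.symm ⟨w, hw⟩⟩, by simp⟩), by
    rintro ⟨i, j⟩
    -- Isomorphisms preserve roots and the block at `f i` has root `f i`, so the inner roots are
    -- placed according to `f`; edges between inner roots are then handled by the embedding `f`
    -- alone.
    have hd : ∀ i, ((d i).1 (s i).root).1 = f.1 i := fun i =>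
      congrArg Subtype.val (d i).map_root
    change (fun p : (Σ i, L i) => ((d p.1).1 p.2).1) _ = t.parent ((d i).1 j).1
    by_cases hj : j = (s i).root
    · subst hj
      rw [comp_parent_root, hd, ← f.2]
      exact hd _
    · rw [comp_parent_of_ne _ _ _ _ hj]
      dsimp only
      rw [(d i).2, coe_piece_parent_of_ne]
      intro h
      exact hj ((d i).1.injective (Subtype.ext (h.trans (hd i).symm)))⟩

/-- An isomorphism from a composition with prescribed images of the roots of the inner trees is a
family of isomorphisms from the inner trees to the blocks. -/
noncomputable def isoFiberEquiv (f : RootedEmb a t) :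
    {e : Iso (a.comp s) t // e.rootEmb = f} ≃
      ∀ i, Iso (s i) (t.piece (Set.range f.1) (f.1 i)) where
  toFun e := fun i => e.2 ▸ e.1.block i
  invFun d := ⟨Iso.ofBlocks f d, Subtype.ext (Function.Embedding.ext fun i =>
    congrArg Subtype.val (d i).map_root)⟩
  left_inv := by
    rintro ⟨e, rfl⟩
    exact Subtype.ext (Subtype.ext (by ext; rfl))
  right_inv d := by
    have h : (Iso.ofBlocks f d).rootEmb = f := Subtype.ext (Function.Embedding.ext fun i =>
      congrArg Subtype.val (d i).map_root)
    funext i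
    apply Subtype.ext
    ext j
    -- Transport along an equality of embeddings changes the type of the target block but not the
    -- underlying vertices.
    have key : ∀ (g : RootedEmb a t) (hg : g = f)
        (u : Iso (s i) (t.piece (Set.range g.1) (g.1 i))),
        (((hg ▸ u : Iso (s i) (t.piece (Set.range f.1) (f.1 i)))).1 j).1 = (u.1 j).1 := by
      rintro g rfl u
      rfl
    exact key _ h _

/-- Sort the isomorphisms by the images of the inner roots; given these, the isomorphisms onto the
blocks are chosen independently. -/
theorem card_iso_comp [Fintype I] [Finite V] [∀ i, Finite (L i)] (a : NAP I)
    (s : ∀ i, NAP (L i)) (t : NAP V) : Nat.card (Iso (a.comp s) t) =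
      ∑ f : RootedEmb a t, ∏ i, Nat.card (Iso (s i) (t.piece (Set.range f.1) (f.1 i))) := by
  rw [Nat.card_congr (Equiv.sigmaFiberEquiv (Iso.rootEmb (a := a) (s := s) (t := t))).symm,
    Nat.card_sigma]
  exact Finset.sum_congr rfl fun f _ => by rw [Nat.card_congr (isoFiberEquiv f), Nat.card_pi]

end Decomposition

/-! ### Subtrees containing the root, as images of embeddings. -/

section LowerSets

open Classical

/-- The vertex sets of the subtrees containing the root. -/
noncomputable def lowerSets [Fintype V] (t : NAP V) : Finset (Finset V) :=
  Finset.univ.filter fun R => t.root ∈ R ∧ ∀ v ∈ R, t.parent v ∈ R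

theorem mem_lowerSets [Fintype V] {t : NAP V} {R : Finset V} :
    R ∈ t.lowerSets ↔ t.root ∈ R ∧ ∀ v ∈ R, t.parent v ∈ R := by
  simp [lowerSets]

/-- The vertices of the image of an embedding. -/
noncomputable def RootedEmb.image [Fintype I] {a : NAP I} {t : NAP V} (f : RootedEmb a t) :
    Finset V := Finset.univ.map f.1

theorem RootedEmb.mem_image [Fintype I] {a : NAP I} {t : NAP V} (f : RootedEmb a t) (v : V) :
    v ∈ f.image ↔ v ∈ Set.range f.1 := by
  simp [image]

theorem RootedEmb.coe_image [Fintype I] {a : NAP I} {t : NAP V} (f : RootedEmb a t) :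
    (f.image : Set V) = Set.range f.1 := by
  simp [image]

theorem RootedEmb.image_mem_lowerSets [Fintype I] [Fintype V] {a : NAP I} {t : NAP V}
    (f : RootedEmb a t) : f.image ∈ t.lowerSets := by
  simp only [mem_lowerSets, mem_image]
  refine ⟨⟨a.root, f.map_root⟩, ?_⟩
  rintro _ ⟨i, rfl⟩
  exact ⟨a.parent i, f.2 i⟩

/-- A set closed under parents is never left on the way to the root, so cutting the edges that start
outside `R` leaves exactly `R` attached to the root. This realizes `R` as a tree through `piece`. -/
theorem mem_pieceSet_compl [Fintype V] {t : NAP V} {R : Finset V} (hR : R ∈ t.lowerSets) {w : V} :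
    w ∈ t.pieceSet ((R : Set V)ᶜ) t.root ↔ w ∈ R := by
  rw [mem_lowerSets] at hR
  constructor
  · exact pieceSet_induction _ _ _ hR.1 (fun w hw _ _ => by simpa using hw) w
  · intro hw
    have hit : ∀ k, t.parent^[k] w ∈ R := by
      intro k
      induction k with
      | zero => exact hw
      | succ k ih =>
        rw [Function.iterate_succ_apply']
        exact hR.2 _ ih
    obtain ⟨n, hn⟩ := t.reach w
    exact ⟨n, hn, fun k _ h => h (hit k)⟩

/-- The embeddings with image `R` are the isomorphisms onto the subtree spanned by `R`. -/
noncomputable def rootedEmbFiberEquiv [Fintype I] [Fintype V] (a : NAP I) {t : NAP V}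
    {R : Finset V} (hR : R ∈ t.lowerSets) :
    {f : RootedEmb a t // f.image = R} ≃ Iso a (t.piece ((R : Set V)ᶜ) t.root) where
  toFun f := ⟨Equiv.ofBijective (fun i => ⟨f.1.1 i, (mem_pieceSet_compl hR).2 (by
      have h := (f.1.mem_image (f.1.1 i)).2 ⟨i, rfl⟩
      rwa [f.2] at h)⟩) (by
    constructor
    · intro i j h
      exact f.1.1.injective (congrArg Subtype.val h)
    · rintro ⟨w, hw⟩
      rw [mem_pieceSet_compl hR, ← f.2, f.1.mem_image] at hw
      obtain ⟨i, rfl⟩ := hw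
      exact ⟨i, rfl⟩), fun i => by
    apply Subtype.ext
    -- The parent map of `piece` is defined separately at its root; it agrees there with that of `t`
    -- because both fix the root of `t`.
    by_cases hi : f.1.1 i = t.root
    · rw [piece_parent_of_eq _ _ _ _ hi]
      change f.1.1 (a.parent i) = f.1.1 i
      rw [f.1.2, hi, t.parent_root]
    · rw [coe_piece_parent_of_ne _ _ _ _ hi]
      exact f.1.2 i⟩
  invFun e := ⟨⟨⟨fun i => (e.1 i).1, fun i j h => e.1.injective (Subtype.ext h)⟩, fun i => by
    change (e.1 (a.parent i)).1 = t.parent (e.1 i).1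
    rw [e.2]
    by_cases hi : (e.1 i).1 = t.root
    · rw [piece_parent_of_eq _ _ _ _ hi, hi, t.parent_root]
    · rw [coe_piece_parent_of_ne _ _ _ _ hi]⟩, by
    ext w
    rw [RootedEmb.mem_image, ← mem_pieceSet_compl hR]
    constructor
    · rintro ⟨i, rfl⟩
      exact (e.1 i).2
    · intro hw
      exact ⟨e.1.symm ⟨w, hw⟩, congrArg Subtype.val (e.1.apply_symm_apply ⟨w, hw⟩)⟩⟩
  left_inv f := rfl
  right_inv e := Subtype.ext (by ext; rfl)

end LowerSets

/-! ### Values on the forest of branches, and the convolution read on subtrees. -/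

section Branches

open Classical

variable {R : Type*} [CommRing R]

/-- The value on the forest of branches of the root of the multiplicative extension of `x`. -/
noncomputable def branchVal [Fintype V] (x : RTree → R) (t : NAP V) : R :=
  forestVal x t (Finset.univ.erase t.root)

/-- The embedding need not preserve the root, so this serves both for the blocks, hanging anywhere
in `t`, and for the subtrees at the root. -/
theorem IsEmb.forestVal_map_erase [Fintype I] [Finite V] {a : NAP I} {t : NAP V} {f : I ↪ V}
    (hf : IsEmb a t f) (x : RTree → R) :
    forestVal x t ((Finset.univ.map f).erase (f a.root)) = branchVal x a := by
  rw [branchVal, ← hf.forestVal_map, Finset.map_erase]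

theorem branchVal_congr [Fintype I] [Fintype J] {s : NAP I} {t : NAP J} (h : s.cls = t.cls)
    (x : RTree → R) : branchVal x s = branchVal x t := by
  obtain ⟨e, he, hp⟩ := exists_equiv_of_cls_eq h
  have hf : IsEmb s t e.toEmbedding := ⟨fun u _ => hp u, Or.inl he⟩
  rw [← hf.forestVal_map_erase, Finset.map_univ_equiv, branchVal]
  exact congrArg (fun v => forestVal x t (Finset.univ.erase v)) he

theorem branchVal_of_subsingleton [Fintype V] [Subsingleton V] (x : RTree → R) (t : NAP V) :
    branchVal x t = 1 := by
  rw [branchVal, Finset.eq_empty_of_forall_notMem fun v hv =>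
    (Finset.mem_erase.1 hv).1 (Subsingleton.elim _ _), forestVal_empty]

theorem branchVal_zero [Fintype V] [Nontrivial V] (t : NAP V) :
    branchVal (0 : RTree → R) t = 0 := by
  obtain ⟨u, hu⟩ := exists_ne t.root
  obtain ⟨v, hv⟩ := t.exists_mem_tops ⟨u, Finset.mem_erase.2 ⟨hu, Finset.mem_univ u⟩⟩
  rw [branchVal, forestVal]
  exact Finset.prod_eq_zero hv (Pi.zero_apply _)

theorem forestVal_biUnion [Finite V] {ι : Type} (x : RTree → R) (t : NAP V) (S : Finset ι)
    (A : ι → Finset V) (h : ∀ i ∈ S, ∀ j ∈ S, i ≠ j → t.Separated (A i) (A j)) :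
    forestVal x t (S.biUnion A) = ∏ i ∈ S, forestVal x t (A i) := by
  induction S using Finset.induction_on with
  | empty => simp [forestVal_empty]
  | insert i S hi ih =>
    have hsep : t.Separated (A i) (S.biUnion A) := by
      have h' : ∀ j ∈ S, t.Separated (A i) (A j) := fun j hj =>
        h i (Finset.mem_insert_self _ _) j (Finset.mem_insert_of_mem hj) fun hij => hi (hij ▸ hj)
      refine ⟨(Finset.disjoint_biUnion_right _ _ _).2 fun j hj => (h' j hj).1, ?_, ?_⟩
      · intro v hv hp
        obtain ⟨j, hj, hp⟩ := Finset.mem_biUnion.1 hp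
        exact (h' j hj).2.1 v hv hp
      · intro v hv hp
        obtain ⟨j, hj, hv⟩ := Finset.mem_biUnion.1 hv
        exact (h' j hj).2.2 v hv hp
    rw [Finset.biUnion_insert, hsep.forestVal_union, Finset.prod_insert hi, ih fun j hj k hk =>
      h j (Finset.mem_insert_of_mem hj) k (Finset.mem_insert_of_mem hk)]

/-- If the parent of `r` were in the piece above `r`, then `r` would be periodic under the parent
map; as iteration ends at the fixed root, `r` would be the root. -/
theorem isEmb_piece (t : NAP V) (c : Set V) (r : V) :
    IsEmb (t.piece c r) t (Function.Embedding.subtype _) := by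
  refine ⟨fun u hu => coe_piece_parent_of_ne _ _ _ _ fun h => hu (Subtype.ext h), ?_⟩
  change r = t.root ∨ _
  by_cases h : r = t.root
  · exact Or.inl h
  right
  rintro ⟨⟨u, n, hn, hk⟩, hu⟩
  have hu' : u = t.parent r := hu
  subst hu'
  have hper : ∀ m, t.parent^[m * (n + 1)] r = r := by
    intro m
    induction m with
    | zero => simp
    | succ m ih =>
      rw [Nat.succ_mul, Function.iterate_add_apply, Function.iterate_succ_apply, hn, ih]
  obtain ⟨m, hm⟩ := t.reach r
  apply h
  -- The exponent `m * (n + 1)` is a multiple of the period and is at least `m`, the number of steps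
  -- that already leads to the root.
  rw [← hper m, mul_add, mul_one, Function.iterate_add_apply, hm, iterate_parent_root]

/-- The vertices outside `S` are the vertices of the blocks other than their roots. A vertex of a
block that is not its root has its parent in the same block, so no edge joins two such parts and the
value is multiplicative. -/
theorem forestVal_compl_eq_prod [Fintype V] (x : RTree → R) (t : NAP V) {S : Finset V}
    (hS : S ∈ t.lowerSets) :
    forestVal x t (Finset.univ \ S) = ∏ v ∈ S, branchVal x (t.piece (S : Set V) v) := by
  rw [mem_lowerSets] at hS
  set A : V → Finset V := fun v => (Finset.univ.filter (· ∈ t.pieceSet (S : Set V) v)).erase v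
    with hA
  have hmem : ∀ v w, w ∈ A v ↔ w ≠ v ∧ w ∈ t.pieceSet (S : Set V) v := by simp [hA]
  -- A vertex of `S` is the root of its own block, hence lies in no other.
  have hnot : ∀ v ∈ S, ∀ w ∈ A v, w ∉ S := by
    intro v hv w hw hwS
    rw [hmem] at hw
    exact hw.1 (mem_pieceSet_unique t hwS hv (self_mem_pieceSet _ _ _) hw.2)
  have hU : Finset.univ \ S = S.biUnion A := by
    ext w
    simp only [Finset.mem_sdiff, Finset.mem_univ, true_and, Finset.mem_biUnion]
    constructor
    · intro hw
      obtain ⟨r, hr, hwr⟩ := t.exists_mem_pieceSet (c := (S : Set V)) hS.1 w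
      exact ⟨r, hr, (hmem _ _).2 ⟨fun h => hw (h ▸ hr), hwr⟩⟩
    · rintro ⟨v, hv, hw⟩
      exact hnot v hv w hw
  have hpar : ∀ i ∈ S, ∀ j ∈ S, i ≠ j → ∀ v ∈ A i, t.parent v ∉ A j := by
    intro i hi j hj hij v hv hp
    rw [hmem] at hv hp
    exact hij (mem_pieceSet_unique t hi hj (parent_mem_pieceSet _ _ _ hv.2 hv.1) hp.2)
  rw [hU, forestVal_biUnion]
  · refine Finset.prod_congr rfl fun v _ => ?_
    rw [← (isEmb_piece t (S : Set V) v).forestVal_map_erase]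
    congr 1
    ext w
    rw [hmem]
    simp [piece]
  · intro i hi j hj hij
    refine ⟨Finset.disjoint_left.2 fun w hwi hwj => ?_, hpar i hi j hj hij, hpar j hj i hi hij.symm⟩
    rw [hmem] at hwi hwj
    exact hij (mem_pieceSet_unique t hi hj hwi.2 hwj.2)

/-- On a forest, the multiplicative extension of the convolution is the sum over the lower parts `B`
of that forest (`forestVal_ckConv`). For the forest of branches, adding the root to `B` gives all
subtrees `S` at the root, the empty part corresponding to the root alone. -/
theorem branchVal_ckConv [Fintype V] (x y : RTree → R) (t : NAP V) :
    branchVal (RTree.ckConv x y) t = ∑ S ∈ t.lowerSets,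
      (∏ v ∈ S, branchVal x (t.piece (S : Set V) v)) * forestVal y t (S.erase t.root) := by
  rw [branchVal, forestVal_ckConv, forestConv]
  refine Finset.sum_bij' (fun B _ => insert t.root B) (fun S _ => S.erase t.root) ?_ ?_ ?_ ?_ ?_
  · intro B hB
    rw [Finset.mem_filter, Finset.mem_powerset] at hB
    rw [mem_lowerSets]
    refine ⟨Finset.mem_insert_self _ _, fun v hv => ?_⟩
    rw [Finset.mem_insert] at hv ⊢
    by_cases hp : t.parent v = t.root
    · exact Or.inl hp
    · rcases hv with rfl | hv
      · exact absurd t.parent_root hp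
      -- `LowerIn` only constrains parents in the forest of branches, which is why a parent equal to
      -- the root was treated first.
      · exact Or.inr (hB.2 v hv (by simp [hp]))
  · intro S hS
    rw [mem_lowerSets] at hS
    rw [Finset.mem_filter, Finset.mem_powerset]
    refine ⟨Finset.erase_subset_erase _ (Finset.subset_univ _), fun v hv hp => ?_⟩
    rw [Finset.mem_erase] at hv hp ⊢
    exact ⟨hp.1, hS.2 v hv.2⟩
  · intro B hB
    rw [Finset.mem_filter, Finset.mem_powerset] at hB
    exact Finset.erase_insert fun h => (Finset.mem_erase.1 (hB.1 h)).1 rfl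
  · intro S hS
    exact Finset.insert_erase (mem_lowerSets.1 hS).1
  · intro B hB
    rw [Finset.mem_filter, Finset.mem_powerset] at hB
    have hr : t.root ∉ B := fun h => (Finset.mem_erase.1 (hB.1 h)).1 rfl
    have hS : insert t.root B ∈ t.lowerSets := by
      rw [mem_lowerSets]
      refine ⟨Finset.mem_insert_self _ _, fun v hv => ?_⟩
      rw [Finset.mem_insert] at hv ⊢
      by_cases hp : t.parent v = t.root
      · exact Or.inl hp
      · rcases hv with rfl | hv
        · exact absurd t.parent_root hp
        · exact Or.inr (hB.2 v hv (by simp [hp]))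
    rw [← forestVal_compl_eq_prod x t hS, Finset.erase_insert hr]
    congr 2
    ext v
    simp [and_comm]

/-- The tree obtained by grafting `t` on a new root. -/
noncomputable def graft (t : NAP V) : NAP (Option V) where
  root := none
  parent o := o.bind fun v => by
    classical exact if v = t.root then none else some (t.parent v)
  parent_root := rfl
  reach := by
    have h : ∀ n v, t.parent^[n] v = t.root → ∃ m, (fun o : Option V => o.bind fun v =>
        if v = t.root then none else some (t.parent v))^[m] (some v) = none := by
      intro n
      induction n with
      | zero =>
        intro v hv
        -- The old root is one step away from the new one.
        exact ⟨1, by simpa using hv⟩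
      | succ n ih =>
        intro v hv
        by_cases hr : v = t.root
        · exact ⟨1, by simp [hr]⟩
        · obtain ⟨m, hm⟩ := ih _ hv
          refine ⟨m + 1, ?_⟩
          rw [Function.iterate_succ_apply, Option.bind_some, if_neg hr]
          exact hm
    rintro (_ | v)
    · exact ⟨0, rfl⟩
    · obtain ⟨n, hn⟩ := t.reach v
      exact h n v hn

theorem branchVal_graft [Fintype V] (x : RTree → R) (t : NAP V) :
    branchVal x t.graft = x t.cls := by
  have hf : IsEmb t t.graft Function.Embedding.some := by
    refine ⟨fun u hu => by simp [graft, hu], Or.inr ?_⟩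
    rintro ⟨u, hu⟩
    simp [graft] at hu
  rw [← forestVal_univ x t, ← hf.forestVal_map, branchVal]
  congr 1
  ext o
  cases o <;> simp [graft]

end Branches

end NAP

namespace RTree

open NAP

/-! ### Branch series and their composition. -/

section Series

open Classical

variable (K : Type*) {A : Type*} [Field K] [CommRing A] [Algebra K A]

/-- The series whose coefficient at `T` is the value of the multiplicative extension of `x` on the
forest of branches of `T`, divided by the number of automorphisms of `T`. -/
noncomputable def branchSeries (x : RTree → A) (T : RTree) : A :=
  algebraMap K A (T.autCard : K)⁻¹ * branchVal x T.rep

/-- Characteristic zero enters the composition formula through this cancellation. -/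
theorem autCard_mul_inv [CharZero K] (T : RTree) :
    (T.autCard : A) * algebraMap K A (T.autCard : K)⁻¹ = 1 := by
  rw [← map_natCast (algebraMap K A), ← map_mul,
    mul_inv_cancel₀ (Nat.cast_ne_zero.2 T.autCard_ne_zero), map_one]

theorem mem_finite_size_le {n : ℕ} {T : RTree} :
    T ∈ (finite_size_le n).toFinset ↔ T.size ≤ n := by
  simp

/-- If `α(s) = T` there are `|Aut T|` isomorphisms between the representatives, and otherwise none.
The weights thus replace the condition `α(s) = T`, and the families `s` range over a full product,
where sums of products over the vertices of `α` factor. -/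
theorem autCard_mul_sum_decomp (F : (Σ α : RTree, (Fin α.size → RTree)) → A) (T : RTree) :
    (T.autCard : A) * ∑ p ∈ T.decomp, F p =
      ∑ α ∈ (finite_size_le T.size).toFinset,
        ∑ s ∈ Fintype.piFinset fun _ : Fin α.size => (finite_size_le T.size).toFinset,
          (Nat.card (Iso (α.rep.comp fun i => (s i).rep) T.rep) : A) * F ⟨α, s⟩ := by
  rw [Finset.sum_sigma', Finset.mul_sum]
  refine (Finset.sum_congr rfl fun p hp => ?_).trans
    (Finset.sum_subset (s₁ := T.decomp) (fun p hp => ?_) fun p _ hp => ?_)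
  · rw [mem_decomp] at hp
    have h : (p.1.rep.comp fun i => (p.2 i).rep).cls = T.rep.cls := hp.trans (cls_rep T).symm
    rw [card_iso, if_pos h]
    change _ = ((p.1.subst p.2).autCard : A) * F p
    rw [hp]
  · rw [mem_decomp] at hp
    rw [Finset.mem_sigma, mem_finite_size_le, Fintype.mem_piFinset]
    refine ⟨hp ▸ size_le_subst _ _, fun i => mem_finite_size_le.2 (hp ▸ size_apply_le_subst _ _ i)⟩
  · rw [mem_decomp] at hp
    rw [card_iso, if_neg fun h => hp (h.trans (cls_rep T)), Nat.cast_zero, zero_mul]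

/-- Only the class of `t` contributes, with `|Aut| · |Aut|⁻¹`. The bound `n` is free because the
same range of trees is used for `T`, its blocks and its subtrees. -/
theorem sum_card_iso [CharZero K] {I : Type} [Fintype I] (x : RTree → A) (t : NAP I) {n : ℕ}
    (hn : Nat.card I ≤ n) :
    ∑ S ∈ (finite_size_le n).toFinset,
      (Nat.card (Iso S.rep t) : A) * (algebraMap K A (S.autCard : K)⁻¹ * x S) = x t.cls := by
  rw [Finset.sum_eq_single t.cls]
  · rw [card_iso, cls_rep, if_pos rfl, ← mul_assoc, autCard_mul_inv, one_mul]
  · intro S _ hS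
    rw [card_iso, cls_rep, if_neg hS, Nat.cast_zero, zero_mul]
  · intro h
    exact absurd (mem_finite_size_le.2 (by rwa [size_cls])) h

/-- A subtree `S` is the image of as many embeddings of `α` as there are isomorphisms from `α` to
`S`; summed over `α` with weight `1 / |Aut α|`, each `S` counts once. -/
theorem sum_rootedEmb [CharZero K] {V : Type} [Fintype V] (t : NAP V) (G : Finset V → A) {n : ℕ}
    (hn : Nat.card V ≤ n) :
    ∑ α ∈ (finite_size_le n).toFinset,
      ∑ f : RootedEmb α.rep t, algebraMap K A (α.autCard : K)⁻¹ * G f.image =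
    ∑ S ∈ t.lowerSets, G S := by
  have h : ∀ α : RTree,
      ∑ f : RootedEmb α.rep t, algebraMap K A (α.autCard : K)⁻¹ * G f.image =
      ∑ S ∈ t.lowerSets, (Nat.card (Iso α.rep (t.piece ((S : Set V)ᶜ) t.root)) : A) *
        (algebraMap K A (α.autCard : K)⁻¹ * G S) := by
    intro α
    rw [← Finset.sum_fiberwise_of_maps_to fun f _ => f.image_mem_lowerSets]
    refine Finset.sum_congr rfl fun S hS => ?_
    rw [← Nat.card_congr (rootedEmbFiberEquiv α.rep hS), Nat.card_eq_fintype_card,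
      Fintype.card_subtype, ← nsmul_eq_mul, ← Finset.sum_const]
    refine Finset.sum_congr rfl fun f hf => ?_
    rw [(Finset.mem_filter.1 hf).2]
  rw [Finset.sum_congr rfl fun α _ => h α, Finset.sum_comm]
  exact Finset.sum_congr rfl fun S _ =>
    -- For fixed `S` the factor `G S` does not depend on `α`, so the function on trees is constant.
    sum_card_iso K (fun _ => G S) (t.piece ((S : Set V)ᶜ) t.root)
      ((Finite.card_subtype_le _).trans hn)

theorem branchVal_ckConv_eq_sum [CharZero K] (x y : RTree → A) {V : Type} [Fintype V] (t : NAP V)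
    {n : ℕ} (hn : Nat.card V ≤ n) :
    branchVal (ckConv x y) t = ∑ α ∈ (finite_size_le n).toFinset,
      ∑ s ∈ Fintype.piFinset fun _ : Fin α.size => (finite_size_le n).toFinset,
        (Nat.card (Iso (α.rep.comp fun i => (s i).rep) t) : A) *
          (branchSeries K y α * ∏ i, branchSeries K x (s i)) := by
  rw [branchVal_ckConv, ← sum_rootedEmb K t _ hn]
  refine Finset.sum_congr rfl fun α _ => ?_
  -- For a fixed embedding, the value of `x` on the branches of each block is a sum over all
  -- possible inner trees; expanding the product over the blocks yields the sum over families `s`.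
  have h : ∀ f : RootedEmb α.rep t,
      (∏ v ∈ f.image, branchVal x (t.piece (f.image : Set V) v)) *
        forestVal y t (f.image.erase t.root) =
      ∑ s ∈ Fintype.piFinset fun _ : Fin α.size => (finite_size_le n).toFinset,
        (∏ i, (Nat.card (Iso (s i).rep (t.piece (Set.range f.1) (f.1 i))) : A) *
          branchSeries K x (s i)) * branchVal y α.rep := by
    intro f
    rw [← Finset.sum_mul, ← Finset.prod_univ_sum (fun _ => (finite_size_le n).toFinset)
      fun i S => (Nat.card (Iso S.rep (t.piece (Set.range f.1) (f.1 i))) : A) *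
        branchSeries K x S]
    congr 1
    · rw [f.coe_image, RootedEmb.image, Finset.prod_map]
      refine Finset.prod_congr rfl fun i _ => ?_
      refine Eq.trans ?_ (sum_card_iso K (fun S => branchVal x S.rep)
        (t.piece (Set.range f.1) (f.1 i)) ((Finite.card_subtype_le _).trans hn)).symm
      exact branchVal_congr (cls_rep _).symm x
    -- The embedding carries the branches of `α` to its image deprived of the root of `t`.
    · rw [← f.isEmb.forestVal_map_erase, f.map_root]
      rfl
  simp only [card_iso_comp, Nat.cast_sum, Nat.cast_prod, Finset.sum_mul]
  rw [Finset.sum_comm]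
  refine Finset.sum_congr rfl fun f _ => ?_
  rw [h, Finset.mul_sum]
  refine Finset.sum_congr rfl fun s _ => ?_
  rw [Finset.prod_mul_distrib, branchSeries]
  ring

/-- Both sides, multiplied by `|Aut T|`, are the same weighted count of isomorphisms onto `T`. -/
theorem seriesComp_branchSeries [CharZero K] (x y : RTree → A) :
    seriesComp (branchSeries K y) (branchSeries K x) = branchSeries K (ckConv x y) := by
  funext T
  rw [branchSeries, branchVal_ckConv_eq_sum K x y T.rep (Nat.card_fin T.size).le,
    ← autCard_mul_sum_decomp (fun p => branchSeries K y p.1 * ∏ i, branchSeries K x (p.2 i)),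
    mul_left_comm, ← mul_assoc, autCard_mul_inv, one_mul, seriesComp]

/-- The one-vertex tree has no branch and one automorphism. This is the normalization required by
`g_• = 1` and by membership in `GNAP`. -/
theorem branchSeries_dot (x : RTree → A) : branchSeries K x dot = 1 := by
  have hs : Subsingleton (Fin dot.size) := by rw [size_dot]; infer_instance
  have h1 : dot.autCard = 1 := by
    rw [autCard, Nat.card_eq_one_iff_unique]
    exact ⟨⟨fun e f => Subtype.ext (Equiv.ext fun v => Subsingleton.elim _ _)⟩,
      ⟨⟨Equiv.refl _, fun _ => rfl⟩⟩⟩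
  rw [branchSeries, h1, branchVal_of_subsingleton]
  simp

/-- Each coefficient is a monomial in the values of `x` with a coefficient in `K`. This naturality
transfers the composition formula between `HCK`, its tensor square and the values of characters. -/
theorem map_branchSeries {B : Type*} [CommRing B] [Algebra K B] (φ : A →ₐ[K] B) (x : RTree → A)
    (T : RTree) : φ (branchSeries K x T) = branchSeries K (fun S => φ (x S)) T := by
  simp only [branchSeries, branchVal, forestVal, map_mul, map_prod, AlgHom.commutes]

/-- A tree other than the one-vertex tree has at least one branch, which contributes a zero factor.
This gives compatibility with the counits, the counit of `HCK` being zero on trees. -/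
theorem branchSeries_zero (T : RTree) : branchSeries K (0 : RTree → A) T = seriesOne T := by
  by_cases h : T = dot
  · rw [h, branchSeries_dot, seriesOne_dot]
  · have h1 : Nontrivial (Fin T.size) := by
      rw [← Fintype.one_lt_card_iff_nontrivial, Fintype.card_fin]
      exact lt_of_le_of_ne T.size_pos fun h' => h (eq_dot_of_size h'.symm)
    rw [branchSeries, branchVal_zero, mul_zero, seriesOne, if_neg h]

end Series

end RTree

/-! ### The morphism of bialgebras and its surjectivity. -/

namespace CoordNAP

variable (K : Type*) [Field K]

/-- The algebra morphism from the coordinate functions to the Connes–Kreimer algebra sending `g_T`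
to the forest of branches of `T` divided by the number of automorphisms of `T`. -/
noncomputable def toHCK : CoordNAP K →ₐ[K] HCK K := lift (RTree.branchSeries K HCK.tree)

theorem toHCK_g (T : RTree) : toHCK K (g T) = RTree.branchSeries K HCK.tree T :=
  lift_g _ (RTree.branchSeries_dot K _) T

/-- The grafted tree has `T` as its only branch, so the generator `T` is the image of its coordinate
function times its number of automorphisms. -/
theorem toHCK_surjective [CharZero K] : Function.Surjective (toHCK K) := by
  have hg : ∀ T, (HCK.tree T : HCK K) ∈ (toHCK K).range := by
    intro T
    have h : (HCK.tree T : HCK K) = algebraMap K (HCK K) (T.rep.graft.cls.autCard : K) *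
        toHCK K (g T.rep.graft.cls) := by
      rw [toHCK_g, RTree.branchSeries, ← mul_assoc, ← map_mul,
        mul_inv_cancel₀ (Nat.cast_ne_zero.2 (RTree.autCard_ne_zero _)), map_one, one_mul,
        NAP.branchVal_congr (RTree.cls_rep _), NAP.branchVal_graft, RTree.cls_rep]
    rw [h]
    exact mul_mem (algebraMap_mem _ _) ⟨_, rfl⟩
  intro a
  change a ∈ (toHCK K).range
  refine MvPolynomial.induction_on (R := K) (σ := RTree) (motive := fun p => p ∈ (toHCK K).range) a
    (fun c => (toHCK K).range.algebraMap_mem c) (fun p q hp hq => add_mem hp hq)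
    fun p T hp => mul_mem hp (hg T)

theorem counit_toHCK (T : RTree) :
    Coalgebra.counit (R := K) (toHCK K (g T)) = Coalgebra.counit (R := K) (g T : CoordNAP K) := by
  refine Eq.trans ?_ (counitHom_g T).symm
  change HCK.counitHom K (toHCK K (g T)) = _
  rw [toHCK_g, RTree.map_branchSeries, ← RTree.branchSeries_zero K]
  congr 1
  exact funext HCK.counitHom_tree

/-- The composition formula for the two functions `T ⊗ 1` and `1 ⊗ T` with values in the tensor
square: their convolution is the coproduct of `HCK`, and the composition of their branch series is
the image of the coproduct of `CoordNAP`. -/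
theorem comul_toHCK [CharZero K] (T : RTree) :
    Algebra.TensorProduct.map (toHCK K) (toHCK K) (comulHom K (g T)) =
      HCK.comulHom K (toHCK K (g T)) := by
  rw [toHCK_g, RTree.map_branchSeries, funext HCK.comulHom_tree]
  change _ = RTree.branchSeries K (RTree.ckConv _ _) T
  rw [← RTree.seriesComp_branchSeries, comulHom_g, RTree.map_seriesComp]
  simp only [Algebra.TensorProduct.map_tmul, map_one, toHCK_g]
  have h1 : RTree.branchSeries K (fun S => (HCK.tree S : HCK K) ⊗ₜ[K] (1 : HCK K)) =
      fun S => RTree.branchSeries K HCK.tree S ⊗ₜ[K] (1 : HCK K) := funext fun S =>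
    (RTree.map_branchSeries K (Algebra.TensorProduct.includeLeft :
      HCK K →ₐ[K] HCK K ⊗[K] HCK K) _ S).symm
  have h2 : RTree.branchSeries K (fun S => (1 : HCK K) ⊗ₜ[K] (HCK.tree S : HCK K)) =
      fun S => (1 : HCK K) ⊗ₜ[K] RTree.branchSeries K HCK.tree S := funext fun S =>
    (RTree.map_branchSeries K (Algebra.TensorProduct.includeRight :
      HCK K →ₐ[K] HCK K ⊗[K] HCK K) _ S).symm
  rw [h1, h2]

/-- `toHCK` as a morphism of bialgebras. -/
noncomputable def toHCKBialgHom [CharZero K] : CoordNAP K →ₐc[K] HCK K :=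
  .ofAlgHom (toHCK K) (algHom_ext (counit_toHCK K)) (algHom_ext (comul_toHCK K))

end CoordNAP

/-! ### Antipodes and the embedding of the character group. -/

theorem BialgHom.map_antipode {R A B : Type*} [CommSemiring R] [Semiring A] [Semiring B]
    [HopfAlgebra R A] [HopfAlgebra R B] (φ : A →ₐc[R] B) (a : A) :
    φ (HopfAlgebra.antipode R a) = HopfAlgebra.antipode R (φ a) := by
  let f : A →ₗ[R] B := (φ : A →ₗc[R] B).toLinearMap
  -- In the convolution algebra of linear maps from `A` to `B`, composing `f` with the antipode of
  -- `B` gives a left inverse of `f`, and with that of `A` a right inverse; hence they coincide.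
  have h1 : WithConv.toConv (HopfAlgebra.antipode R ∘ₗ f) * WithConv.toConv f = 1 := by
    have h := LinearMap.convMul_comp_coalgHom_distrib
      (WithConv.toConv (HopfAlgebra.antipode R (A := B))) (WithConv.toConv LinearMap.id)
      (φ : A →ₗc[R] B)
    rw [LinearMap.antipode_mul_id] at h
    refine WithConv.ofConv_injective (h.symm.trans (LinearMap.ext fun a => ?_))
    exact congrArg (algebraMap R B) (CoalgHomClass.counit_comp_apply φ a)
  have h2 : WithConv.toConv f * WithConv.toConv (f ∘ₗ HopfAlgebra.antipode R) = 1 := by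
    have h := LinearMap.algHom_comp_convMul_distrib (φ : A →ₐ[R] B)
      (WithConv.toConv LinearMap.id) (WithConv.toConv (HopfAlgebra.antipode R (A := A)))
    rw [LinearMap.id_mul_antipode] at h
    refine WithConv.ofConv_injective (h.symm.trans (LinearMap.ext fun a => ?_))
    exact (φ : A →ₐ[R] B).commutes _
  exact (LinearMap.congr_fun (congrArg WithConv.ofConv (left_inv_eq_right_inv h1 h2)) a).symm

theorem corollary4p17 (K : Type*) [Field K] [CharZero K] :
    ∃ φ : CoordNAP K →ₐc[K] HCK K,
      (∀ a, φ (HopfAlgebra.antipode K a) = HopfAlgebra.antipode K (φ a)) ∧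
      Function.Surjective φ ∧
      ∃ ι : WithConv (HCK K →ₐ[K] K) →* GNAP K,
        Function.Injective ι ∧
        ∀ (χ : WithConv (HCK K →ₐ[K] K)) (T : RTree),
          (ι χ).coeff T = χ.ofConv (φ (CoordNAP.g T)) := by
  -- The series attached to a character is the branch series of its values on trees, so the
  -- composition formula over `K` gives multiplicativity.
  have hι : ∀ (χ : WithConv (HCK K →ₐ[K] K)) (T : RTree), χ.ofConv (CoordNAP.toHCK K (CoordNAP.g T)) =
      RTree.branchSeries K (fun S => χ.ofConv (HCK.tree S)) T := fun χ T => by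
    rw [CoordNAP.toHCK_g, RTree.map_branchSeries]
  let ι : WithConv (HCK K →ₐ[K] K) →* GNAP K := MonoidHom.mk'
    (fun χ => ⟨fun T => χ.ofConv (CoordNAP.toHCK K (CoordNAP.g T)), by
      rw [CoordNAP.g_dot, map_one, map_one]⟩) fun χ ψ => by
    apply GNAP.ext
    rw [GNAP.coeff_mul]
    simp only [hι]
    change _ = RTree.seriesComp (RTree.branchSeries K _) (RTree.branchSeries K _)
    rw [RTree.seriesComp_branchSeries]
    change RTree.branchSeries K _ = _
    congr 1
    funext S
    -- It remains to see that the product of characters, restricted to trees, is `ckConv` of the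
    -- restrictions; this comes from applying `χ ⊗ ψ` and multiplication to the coproduct of a tree.
    change (Algebra.TensorProduct.lmul' K).comp (Algebra.TensorProduct.map χ.ofConv ψ.ofConv)
      (HCK.comulHom K (HCK.tree S)) = _
    rw [HCK.comulHom_tree, RTree.map_ckConv]
    simp
  refine ⟨CoordNAP.toHCKBialgHom K, BialgHom.map_antipode _, CoordNAP.toHCK_surjective K, ι, ?_,
    fun _ _ => rfl⟩
  intro χ ψ h
  -- Equal series mean that the composites with `toHCK` agree on the generators `g_T`; surjectivity
  -- of `toHCK` then gives equality of the characters.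
  have h1 : χ.ofConv.comp (CoordNAP.toHCK K) = ψ.ofConv.comp (CoordNAP.toHCK K) :=
    CoordNAP.algHom_ext fun T => congrFun (congrArg GNAP.coeff h) T
  have h2 : χ.ofConv = ψ.ofConv := AlgHom.ext fun a => by
    obtain ⟨b, rfl⟩ := CoordNAP.toHCK_surjective K a
    exact DFunLike.congr_fun h1 b
  exact WithConv.ofConv_injective h2
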